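/- **Setting.** There are $N$ base arms; arm $a\in[N]$ has a fixed reward distribution $p_a$ supported on $[0,1]$ with mean $r_a$. A family $\Theta\subseteq 2^{[N]}$ of feasible super arms is given, and $m:=\max_{A\in\Theta}|A|$. In each round $t=1,2,\dots$ a nonempty family $\Theta_t\subseteq\Theta$ of available super arms is revealed; it may be chosen by an adaptive (possibly randomized) adversary, that is, depending on everything that happened before round $t$, but not on the randomness of round $t$. The learner plays $A_t\in\Theta_t$ and observes a reward $r_{a,t}\sim p_a$ for every $a\in A_t$; the rewards of round $t$ are independent of the past and of the learner's choice in round $t$, while the rewards of different arms in the same round may be dependent. The $T$-round regret is $$\mathcal R(T)=\sum_{t=1}^T\mathbf E\Big[\max_{A\in\Theta_t}\sum_{a\in A}r_a-\sum_{a\in A_t}r_a\Big].$$ **Algorithm CL-SG** with exploration rate $\gamma>0$. Let $n_{a,t}$ be the number of rounds $\tau<t$ with $a\in A_\tau$, and let $\hat r_{a,t}$ be the average of the rewards of $a$ observed in these rounds ($\hat r_{a,t}=0$ if $n_{a,t}=0$). In round $t$ the algorithm draws one seed $w_t\sim\mathcal N(0,1)$, independent of the past and of $\Theta_t$, sets $$\bar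 r_{a,t}=\hat r_{a,t}+w_t\sqrt{\frac{\gamma\ln t}{n_{a,t}+1}}\qquad(a\in[N]),$$ and plays some $A_t\in\arg\max_{A\in\Theta_t}\sum_{a\in A}\bar r_{a,t}$, ties being broken arbitrarily. **Theorem.** Let $\gamma>0$. 1. There is a constant $C$, depending only on $\gamma$, such that for every instance as above, every availability process, and every $T\ge 2$, the regret of CL-SG satisfies $\mathcal R(T)\le C\,\ln T\,\sqrt{mNT}$. 2. There are a constant $c>0$ and an integer $T_0$, depending only on $\gamma$, such that for every $m\ge1$ and every $T\ge T_0$ there is a top-$m$ instance with $N=2m$ base arms (all $m$-element subsets of $[N]$, and no others, are feasible, and all of them are available in every round) which CL-SG can be run on, and on which it suffers regret $\mathcal R(T)\ge c\,\sqrt{mNT\ln T}$, however ties are broken. -/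

import Mathlib

open MeasureTheory ProbabilityTheory

noncomputable section

/-- A sleeping semi-bandit instance with base arms `Fin N`: a family of feasible super arms and,
for every base arm, a reward distribution supported on `[0, 1]`. -/
structure SemiBandit (N : ℕ) where
  feasible : Finset (Finset (Fin N))
  law : Fin N → Measure ℝ
  isProb : ∀ a, IsProbabilityMeasure (law a)
  support : ∀ a, ∀ᵐ x ∂(law a), x ∈ Set.Icc (0 : ℝ) 1

namespace SemiBandit

variable {N : ℕ} (I : SemiBandit N)

/-- The mean reward `r_a` of a base arm. -/
def mean (a : Fin N) : ℝ := ∫ x, x ∂(I.law a)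

/-- The maximum cardinality `m` of a feasible super arm. -/
def maxCard : ℕ := I.feasible.sup Finset.card

/-- The mean reward of a super arm. -/
def value (B : Finset (Fin N)) : ℝ := ∑ a ∈ B, I.mean a

/-- The mean reward of an optimal super arm in a nonempty family `S` of super arms. -/
def optValue (S : Finset (Finset (Fin N))) : ℝ :=
  if h : S.Nonempty then S.sup' h I.value else 0

/-- The top-`m` constraint: the feasible super arms are exactly the `m`-element sets. -/
def IsTop (m : ℕ) : Prop := I.feasible = Finset.univ.powersetCard m

end SemiBandit

/-! Rounds are `t = 1, 2, …`. The lists of played super arms and of rewards along one outcome are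
`A : ℕ → Finset (Fin N)` and `X : ℕ → Fin N → ℝ`; their entries at `0` are never used. -/

/-- `n_{a,t}`: number of plays of `a` in the rounds `1, …, t - 1`. -/
def pulls {N : ℕ} (A : ℕ → Finset (Fin N)) (a : Fin N) (t : ℕ) : ℕ :=
  ((Finset.Ico 1 t).filter (fun τ => a ∈ A τ)).card

/-- Empirical mean of `a` at the beginning of round `t`; it is `0` if `a` was never played. -/
def empMean {N : ℕ} (A : ℕ → Finset (Fin N)) (X : ℕ → Fin N → ℝ) (a : Fin N) (t : ℕ) : ℝ :=
  (∑ τ ∈ (Finset.Ico 1 t).filter (fun τ => a ∈ A τ), X τ a) / (pulls A a t : ℝ)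

/-- The perturbed estimate of `a` in round `t` when the shared seed takes the value `w`. -/
def perturbed {N : ℕ} (γ : ℝ) (A : ℕ → Finset (Fin N)) (X : ℕ → Fin N → ℝ) (w : ℝ)
    (a : Fin N) (t : ℕ) : ℝ :=
  empMean A X a t + w * Real.sqrt (γ * Real.log t / ((pulls A a t : ℝ) + 1))

/-- `IsCLSGRun I γ μ 𝓕 Θ w A X`: on the probability space `(Ω, μ)`, CL-SG with exploration rate `γ`
is run on the instance `I`. `𝓕 t` is the information available at the end of round `t`; it may
contain additional randomness (for the availability of arms and for breaking ties). In round `t`,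
`Θ t` is the family of available super arms, `w t` the seed, `A t` the super arm that is
played, and `X t a` the reward of the base arm `a`.

* The availability is chosen by an adaptive adversary: it may depend on everything that happened
  before, but not on the seed and the rewards of the current round.
* Rewards are independent of the past and of the decision in the current round; the rewards of
  different base arms in one round may depend on each other. -/
structure IsCLSGRun {N : ℕ} (I : SemiBandit N) (γ : ℝ) {Ω : Type*} [mΩ : MeasurableSpace Ω]
    (μ : Measure Ω) (𝓕 : Filtration ℕ mΩ) (Θ : ℕ → Ω → Finset (Finset (Fin N)))
    (w : ℕ → Ω → ℝ) (A : ℕ → Ω → Finset (Fin N)) (X : ℕ → Fin N → Ω → ℝ) : Prop where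
  avail_meas : ∀ t S, MeasurableSet[𝓕 t] {ω | Θ (t + 1) ω = S}
  avail_subset : ∀ t ω, Θ (t + 1) ω ⊆ I.feasible
  avail_nonempty : ∀ t ω, (Θ (t + 1) ω).Nonempty
  seed_meas : ∀ t, Measurable[𝓕 (t + 1)] (w (t + 1))
  seed_law : ∀ t, μ.map (w (t + 1)) = gaussianReal 0 1
  seed_indep : ∀ t, Indep (MeasurableSpace.comap (w (t + 1)) inferInstance) (𝓕 t) μ
  play_meas : ∀ t B, MeasurableSet[𝓕 (t + 1)] {ω | A (t + 1) ω = B}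
  play_mem : ∀ t ω, A (t + 1) ω ∈ Θ (t + 1) ω
  play_max : ∀ t ω, ∀ B ∈ Θ (t + 1) ω,
    ∑ a ∈ B, perturbed γ (fun τ => A τ ω) (fun τ b => X τ b ω) (w (t + 1) ω) a (t + 1) ≤
      ∑ a ∈ A (t + 1) ω,
        perturbed γ (fun τ => A τ ω) (fun τ b => X τ b ω) (w (t + 1) ω) a (t + 1)
  reward_meas : ∀ t a, Measurable[𝓕 (t + 1)] (X (t + 1) a)
  reward_law : ∀ t a, μ.map (X (t + 1) a) = I.law a
  reward_indep : ∀ t,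
    Indep (MeasurableSpace.comap (fun ω a => X (t + 1) a ω) inferInstance)
      (𝓕 t ⊔ MeasurableSpace.comap (w (t + 1)) inferInstance ⊔
        MeasurableSpace.comap (A (t + 1)) ⊤) μ

/-- The `T`-round pseudo-regret. -/
def regret {N : ℕ} (I : SemiBandit N) {Ω : Type*} [MeasurableSpace Ω] (μ : Measure Ω)
    (Θ : ℕ → Ω → Finset (Finset (Fin N))) (A : ℕ → Ω → Finset (Fin N)) (T : ℕ) : ℝ :=
  ∑ t ∈ Finset.Icc 1 T, ∫ ω, (I.optValue (Θ t ω) - I.value (A t ω)) ∂μ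

end

/-! ### Counts of plays -/

/-! Upper bound. Put `K = √(3/γ)`. By concentration, every empirical mean is within `K` bonuses of
its true mean, except with summable probability. The estimates are therefore optimistic at the fixed
seed `K`, and what remains is the cost of the actual seed `w` falling below `K`. For a fixed past,
the perturbed maximum is a maximum of affine functions of the seed, hence convex. Its growth up to
`K` is governed by its increment between `K` and `K + 1`, and this increment is at most its slope at
any seed above `K + 1`, which is the bonus of the arm played there (`perturbedMax_sub_le`,
`perturbedGap_le`). The seed is independent of the past and exceeds `K + 1` with constant
probability, so the expected increment is at most a constant times the expected played bonus
(`integral_perturbedGap_le`). No independence between the perturbations of different arms is needed.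
Cauchy–Schwarz and harmonic sums bound the squared played bonuses by `m γ ln T · N (1 + ln T)`, and
a weighted AM–GM inequality turns this into the regret bound (`regret_le_of_pos`).

Lower bound. Half of the arms pay a deterministic `Δ` of order `√(γ ln T / T)`, the others pay
nothing. While the worthless arms are rarely played, their bonuses exceed those of the good arms by
more than `Δ` whenever the shared seed is above 1. That one event favours all of them at once, so at
least `m/2` are played (`half_le_card_sdiff`). Hence they occupy a constant fraction of the `mT`
plays in expectation (`sum_integral_card_sdiff_ge`). -/

theorem pulls_of_le_one {N : ℕ} (A : ℕ → Finset (Fin N)) (a : Fin N) {t : ℕ} (ht : t ≤ 1) :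
    pulls A a t = 0 := by
  simp [pulls, Finset.Ico_eq_empty_of_le ht]

theorem pulls_eq_sum {N : ℕ} (A : ℕ → Finset (Fin N)) (a : Fin N) (t : ℕ) :
    pulls A a t = ∑ τ ∈ Finset.Ico 1 t, if a ∈ A τ then 1 else 0 := by
  rw [pulls, Finset.card_filter]

theorem pulls_add_two {N : ℕ} (A : ℕ → Finset (Fin N)) (a : Fin N) (t : ℕ) :
    pulls A a (t + 2) = pulls A a (t + 1) + if a ∈ A (t + 1) then 1 else 0 := by
  rw [pulls_eq_sum, pulls_eq_sum, Finset.sum_Ico_succ_top (by omega)]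

theorem pulls_succ_le {N : ℕ} (A : ℕ → Finset (Fin N)) (a : Fin N) (t : ℕ) :
    pulls A a (t + 1) ≤ t := by
  refine (Finset.card_filter_le _ _).trans ?_
  simp

theorem empMean_eq_sum {N : ℕ} (A : ℕ → Finset (Fin N)) (X : ℕ → Fin N → ℝ) (a : Fin N) (t : ℕ) :
    empMean A X a t =
      (∑ τ ∈ Finset.Ico 1 t, if a ∈ A τ then X τ a else 0) / (pulls A a t : ℝ) := by
  rw [empMean, Finset.sum_filter]

theorem empMean_mem_Icc {N : ℕ} {A : ℕ → Finset (Fin N)} {X : ℕ → Fin N → ℝ} {a : Fin N}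
    (hX : ∀ t, X (t + 1) a ∈ Set.Icc (0 : ℝ) 1) (t : ℕ) :
    empMean A X a t ∈ Set.Icc (0 : ℝ) 1 := by
  have h : ∀ τ ∈ (Finset.Ico 1 t).filter (fun τ => a ∈ A τ), X τ a ∈ Set.Icc (0 : ℝ) 1 := by
    intro τ hτ
    obtain ⟨k, rfl⟩ : ∃ k, τ = k + 1 :=
      ⟨τ - 1, by have := (Finset.mem_Ico.1 (Finset.mem_filter.1 hτ).1).1; omega⟩
    exact hX k
  constructor
  · exact div_nonneg (Finset.sum_nonneg fun τ hτ => (h τ hτ).1) (Nat.cast_nonneg _)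
  · refine div_le_one_of_le₀ ?_ (Nat.cast_nonneg _)
    refine (Finset.sum_le_card_nsmul _ _ 1 fun τ hτ => (h τ hτ).2).trans ?_
    simp [pulls]

/-- The sum of the inverse counts along the plays of a single arm is a harmonic sum. -/
theorem sum_inv_pulls_eq {N : ℕ} (A : ℕ → Finset (Fin N)) (a : Fin N) (T : ℕ) :
    ∑ t ∈ Finset.range T, (if a ∈ A (t + 1) then 1 / ((pulls A a (t + 1) : ℝ) + 1) else 0) =
      ∑ k ∈ Finset.range (pulls A a (T + 1)), 1 / ((k : ℝ) + 1) := by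
  induction T with
  | zero => simp [pulls_of_le_one]
  | succ T ih =>
    rw [Finset.sum_range_succ, ih, pulls_add_two]
    split_ifs
    · rw [Finset.sum_range_succ]
    · simp

/-- After exchanging the sums, each arm contributes a harmonic number of index at most `T`. -/
theorem sum_inv_pulls_le {N : ℕ} (A : ℕ → Finset (Fin N)) (T : ℕ) :
    ∑ t ∈ Finset.range T, ∑ a ∈ A (t + 1), 1 / ((pulls A a (t + 1) : ℝ) + 1) ≤
      N * (1 + Real.log T) := by
  have h : ∀ a : Fin N, ∑ t ∈ Finset.range T,
      (if a ∈ A (t + 1) then 1 / ((pulls A a (t + 1) : ℝ) + 1) else 0) ≤ 1 + Real.log T := by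
    intro a
    rw [sum_inv_pulls_eq]
    refine le_trans (Finset.sum_le_sum_of_subset_of_nonneg
      (Finset.range_mono (pulls_succ_le A a T)) fun k _ _ => by positivity) ?_
    refine le_trans (le_of_eq ?_) (harmonic_le_one_add_log T)
    simp [harmonic]
  calc _ = ∑ a : Fin N, ∑ t ∈ Finset.range T,
        (if a ∈ A (t + 1) then 1 / ((pulls A a (t + 1) : ℝ) + 1) else 0) := by
        rw [Finset.sum_comm]
        refine Finset.sum_congr rfl fun t _ => ?_
        rw [← Finset.sum_filter]
        simp
    _ ≤ ∑ _a : Fin N, (1 + Real.log T) := Finset.sum_le_sum fun a _ => h a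
    _ = _ := by simp; ring

/-! ### The perturbed maximum as a function of the seed -/

/-- The exploration bonus of `a` in round `t` per unit of the seed. -/
noncomputable def bonus {N : ℕ} (γ : ℝ) (A : ℕ → Finset (Fin N)) (a : Fin N) (t : ℕ) : ℝ :=
  Real.sqrt (γ * Real.log t / ((pulls A a t : ℝ) + 1))

theorem bonus_nonneg {N : ℕ} (γ : ℝ) (A : ℕ → Finset (Fin N)) (a : Fin N) (t : ℕ) :
    0 ≤ bonus γ A a t := Real.sqrt_nonneg _

theorem bonus_le {N : ℕ} {γ : ℝ} (hγ : 0 < γ) (A : ℕ → Finset (Fin N)) (a : Fin N) (t : ℕ) :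
    bonus γ A a t ≤ Real.sqrt (γ * Real.log t) := by
  refine Real.sqrt_le_sqrt (div_le_self (mul_nonneg hγ.le (Real.log_natCast_nonneg t)) ?_)
  linarith [Nat.cast_nonneg (α := ℝ) (pulls A a t)]

/-- Cauchy–Schwarz over at most `m` played arms leaves inverse counts, whose sum over the rounds is
a harmonic potential. -/
theorem sq_sum_bonus_le {N : ℕ} {γ : ℝ} (hγ : 0 < γ) (A : ℕ → Finset (Fin N)) {t m T : ℕ}
    (hm : (A t).card ≤ m) (ht : 1 ≤ t) (hT : t ≤ T) :
    (∑ a ∈ A t, bonus γ A a t) ^ 2 ≤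
      m * (γ * Real.log T) * ∑ a ∈ A t, 1 / ((pulls A a t : ℝ) + 1) := by
  have hlog : Real.log t ≤ Real.log T :=
    Real.log_le_log (by exact_mod_cast ht) (by exact_mod_cast hT)
  have h0 : 0 ≤ Real.log t := Real.log_natCast_nonneg t
  calc (∑ a ∈ A t, bonus γ A a t) ^ 2
      ≤ (A t).card * ∑ a ∈ A t, bonus γ A a t ^ 2 := sq_sum_le_card_mul_sum_sq
    _ ≤ m * ∑ a ∈ A t, (γ * Real.log T) * (1 / ((pulls A a t : ℝ) + 1)) := by
        refine mul_le_mul (by exact_mod_cast hm) (Finset.sum_le_sum fun a _ => ?_)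
          (Finset.sum_nonneg fun _ _ => sq_nonneg _) (Nat.cast_nonneg _)
        rw [bonus, Real.sq_sqrt (by positivity), ← div_eq_mul_one_div]
        gcongr
    _ = _ := by rw [← Finset.mul_sum]; ring

/-- The maximum over the super arms in `S` of the estimates `e` perturbed by `x * s`. -/
noncomputable def perturbedMax {α : Type*} (S : Finset (Finset α)) (e s : α → ℝ) (x : ℝ) : ℝ :=
  if h : S.Nonempty then S.sup' h (fun B => ∑ a ∈ B, (e a + x * s a)) else 0

theorem le_perturbedMax {α : Type*} {S : Finset (Finset α)} (e s : α → ℝ) (x : ℝ)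
    {B : Finset α} (hB : B ∈ S) : ∑ a ∈ B, (e a + x * s a) ≤ perturbedMax S e s x := by
  have h : S.Nonempty := ⟨B, hB⟩
  rw [perturbedMax, dif_pos h]
  exact Finset.le_sup' (fun B => ∑ a ∈ B, (e a + x * s a)) hB

theorem exists_eq_perturbedMax {α : Type*} {S : Finset (Finset α)} (h : S.Nonempty)
    (e s : α → ℝ) (x : ℝ) : ∃ B ∈ S, perturbedMax S e s x = ∑ a ∈ B, (e a + x * s a) := by
  rw [perturbedMax, dif_pos h]
  exact Finset.exists_mem_eq_sup' h _

/-- The increment of the perturbed maximum between the seeds `x` and `x + 1`. -/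
noncomputable def perturbedGap {α : Type*} (S : Finset (Finset α)) (e s : α → ℝ) (x : ℝ) : ℝ :=
  perturbedMax S e s (x + 1) - perturbedMax S e s x

theorem sum_add_mul {α : Type*} (B : Finset α) (e s : α → ℝ) (x : ℝ) :
    ∑ a ∈ B, (e a + x * s a) = ∑ a ∈ B, e a + x * ∑ a ∈ B, s a := by
  rw [Finset.sum_add_distrib, Finset.mul_sum]

theorem perturbedGap_nonneg {α : Type*} {S : Finset (Finset α)} (h : S.Nonempty)
    (e : α → ℝ) {s : α → ℝ} (hs : ∀ a, 0 ≤ s a) (x : ℝ) : 0 ≤ perturbedGap S e s x := by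
  obtain ⟨B, hB, hBx⟩ := exists_eq_perturbedMax h e s x
  have h1 := le_perturbedMax e s (x + 1) hB
  have h2 : 0 ≤ ∑ a ∈ B, s a := Finset.sum_nonneg fun a _ => hs a
  rw [sum_add_mul] at h1 hBx
  rw [perturbedGap]
  linarith

/-- The perturbed maximum grows at most at the rate `perturbedGap` below `x`. -/
theorem perturbedMax_sub_le {α : Type*} {S : Finset (Finset α)} (h : S.Nonempty)
    (e : α → ℝ) {s : α → ℝ} (hs : ∀ a, 0 ≤ s a) (x w : ℝ) :
    perturbedMax S e s x - perturbedMax S e s w ≤ max (x - w) 0 * perturbedGap S e s x := by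
  obtain ⟨B, hB, hBx⟩ := exists_eq_perturbedMax h e s x
  have h1 := le_perturbedMax e s (x + 1) hB
  have h2 := le_perturbedMax e s w hB
  have h3 : 0 ≤ ∑ a ∈ B, s a := Finset.sum_nonneg fun a _ => hs a
  rw [sum_add_mul] at h1 h2 hBx
  -- The maximizer at `x` still competes at `x + 1`, so its slope is at most the increment.
  have h4 : ∑ a ∈ B, s a ≤ perturbedGap S e s x := by rw [perturbedGap]; linarith
  calc _ ≤ (x - w) * ∑ a ∈ B, s a := by linarith
    _ ≤ max (x - w) 0 * ∑ a ∈ B, s a := mul_le_mul_of_nonneg_right (le_max_left _ _) h3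
    _ ≤ _ := mul_le_mul_of_nonneg_left h4 (le_max_right _ _)

/-- The bonus of a maximizer is nondecreasing in the seed, and dominates earlier increments. -/
theorem perturbedGap_le {α : Type*} {S : Finset (Finset α)} (e s : α → ℝ) {x w : ℝ}
    (hw : x + 1 < w) {A : Finset α} (hA : A ∈ S)
    (hmax : ∀ B ∈ S, ∑ a ∈ B, (e a + w * s a) ≤ ∑ a ∈ A, (e a + w * s a)) :
    perturbedGap S e s x ≤ ∑ a ∈ A, s a := by
  obtain ⟨B, hB, hBx⟩ := exists_eq_perturbedMax ⟨A, hA⟩ e s (x + 1)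
  have h1 := le_perturbedMax e s (x + 1) hA
  have h2 := le_perturbedMax e s x hB
  have h3 := hmax B hB
  rw [hBx] at h1
  rw [perturbedGap, hBx]
  simp only [sum_add_mul] at h1 h2 h3 ⊢
  -- Adding optimality of `B` at `x + 1` to optimality of `A` at `w` cancels the estimates and
  -- compares the slopes.
  have h4 : (w - (x + 1)) * ∑ a ∈ B, s a ≤ (w - (x + 1)) * ∑ a ∈ A, s a := by linarith
  have h5 := le_of_mul_le_mul_left h4 (by linarith)
  linarith

theorem perturbedGap_le_sum {α : Type*} [Fintype α] {S : Finset (Finset α)} (h : S.Nonempty)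
    (e : α → ℝ) {s : α → ℝ} (hs : ∀ a, 0 ≤ s a) (x : ℝ) :
    perturbedGap S e s x ≤ ∑ a, s a := by
  obtain ⟨B, hB, hBx⟩ := exists_eq_perturbedMax h e s (x + 1)
  have h2 := le_perturbedMax e s x hB
  have h3 : ∑ a ∈ B, s a ≤ ∑ a, s a :=
    Finset.sum_le_sum_of_subset_of_nonneg (Finset.subset_univ B) fun a _ _ => hs a
  rw [perturbedGap, hBx]
  simp only [sum_add_mul] at h2 ⊢
  linarith

/-- Regret of one round, when the estimates deviate from the means `r` by at most `K * s + ξ`. -/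
theorem sum_sub_sum_le {α : Type*} [Fintype α] {S : Finset (Finset α)} {e s r ξ : α → ℝ}
    {K w : ℝ} (hs : ∀ a, 0 ≤ s a) (hξ : ∀ a, 0 ≤ ξ a)
    (hdev : ∀ a, |e a - r a| ≤ K * s a + ξ a) {A B : Finset α} (hA : A ∈ S) (hB : B ∈ S)
    (hmax : ∀ B ∈ S, ∑ a ∈ B, (e a + w * s a) ≤ ∑ a ∈ A, (e a + w * s a)) :
    ∑ a ∈ B, r a - ∑ a ∈ A, r a ≤
      (|w| + K) * ∑ a ∈ A, s a + max (K - w) 0 * perturbedGap S e s K + 2 * ∑ a, ξ a := by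
  have hsub : ∀ C : Finset α, ∑ a ∈ C, ξ a ≤ ∑ a, ξ a := fun C =>
    Finset.sum_le_sum_of_subset_of_nonneg (Finset.subset_univ C) fun a _ _ => hξ a
  -- Optimism at the seed `K`: the competitor is bounded by the perturbed maximum at `K`, which is
  -- then moved to the actual seed `w`.
  have h1 : ∑ a ∈ B, r a ≤ ∑ a ∈ B, (e a + K * s a) + ∑ a ∈ B, ξ a := by
    rw [← Finset.sum_add_distrib]
    exact Finset.sum_le_sum fun a _ => by linarith [(abs_le.1 (hdev a)).1]
  have h2 : ∑ a ∈ A, (e a - K * s a) - ∑ a ∈ A, ξ a ≤ ∑ a ∈ A, r a := by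
    rw [← Finset.sum_sub_distrib]
    exact Finset.sum_le_sum fun a _ => by linarith [(abs_le.1 (hdev a)).2]
  have h3 := le_perturbedMax e s K hB
  have h4 : perturbedMax S e s w ≤ ∑ a ∈ A, (e a + w * s a) := by
    obtain ⟨C, hC, hCx⟩ := exists_eq_perturbedMax ⟨A, hA⟩ e s w
    exact hCx ▸ hmax C hC
  have h5 := perturbedMax_sub_le ⟨A, hA⟩ e hs K w
  have h6 : 0 ≤ ∑ a ∈ A, s a := Finset.sum_nonneg fun a _ => hs a
  have h7 := mul_le_mul_of_nonneg_right (le_abs_self w) h6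
  have h8 := hsub A
  have h9 := hsub B
  rw [Finset.sum_sub_distrib, ← Finset.mul_sum] at h2
  rw [sum_add_mul] at h4
  linarith

/-- The total deviation of the observed rewards of `a` in the rounds `1, …, t` from the mean. -/
noncomputable def deviation {N : ℕ} {Ω : Type*} (I : SemiBandit N) (A : ℕ → Ω → Finset (Fin N))
    (X : ℕ → Fin N → Ω → ℝ) (a : Fin N) (t : ℕ) (ω : Ω) : ℝ :=
  ∑ τ ∈ Finset.Ico 1 (t + 1), if a ∈ A τ ω then X τ a ω - I.mean a else 0

theorem deviation_succ {N : ℕ} {Ω : Type*} {I : SemiBandit N} {A : ℕ → Ω → Finset (Fin N)}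
    {X : ℕ → Fin N → Ω → ℝ} (a : Fin N) (t : ℕ) (ω : Ω) :
    deviation I A X a (t + 1) ω = deviation I A X a t ω +
      if a ∈ A (t + 1) ω then X (t + 1) a ω - I.mean a else 0 := by
  rw [deviation, deviation, Finset.sum_Ico_succ_top (by omega)]

theorem deviation_eq {N : ℕ} {Ω : Type*} {I : SemiBandit N} {A : ℕ → Ω → Finset (Fin N)}
    {X : ℕ → Fin N → Ω → ℝ} (a : Fin N) (t : ℕ) (ω : Ω)
    (hn : pulls (fun τ => A τ ω) a (t + 1) ≠ 0) :
    deviation I A X a t ω = pulls (fun τ => A τ ω) a (t + 1) *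
      (empMean (fun τ => A τ ω) (fun τ b => X τ b ω) a (t + 1) - I.mean a) := by
  have hn' : (pulls (fun τ => A τ ω) a (t + 1) : ℝ) ≠ 0 := by exact_mod_cast hn
  rw [mul_sub, empMean, mul_div_cancel₀ _ hn', deviation, ← Finset.sum_filter,
    Finset.sum_sub_distrib]
  simp [pulls]

/-! ### Measurability along a run -/

/-- Availability and plays are random elements of finite types whose measurability is only given
fibrewise; gluing over the fibres handles everything indexed by them. -/
theorem measurable_of_finite_index {Ω ι β : Type*} {m : MeasurableSpace Ω} [MeasurableSpace β]
    [Finite ι] {θ : Ω → ι} (hθ : ∀ i, MeasurableSet {ω | θ ω = i}) {g : ι → Ω → β}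
    (hg : ∀ i, Measurable (g i)) : Measurable (fun ω => g (θ ω) ω) := by
  intro s hs
  have : (fun ω => g (θ ω) ω) ⁻¹' s = ⋃ i, {ω | θ ω = i} ∩ g i ⁻¹' s := by
    ext ω; simp
  rw [this]
  exact MeasurableSet.iUnion fun i => (hθ i).inter (hg i hs)

theorem measurable_perturbedMax {Ω α : Type*} {m : MeasurableSpace Ω} [Finite α]
    {θ : Ω → Finset (Finset α)} (hθ : ∀ S, MeasurableSet {ω | θ ω = S}) {e s : α → Ω → ℝ}
    (he : ∀ a, Measurable (e a)) (hs : ∀ a, Measurable (s a)) (x : ℝ) :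
    Measurable (fun ω => perturbedMax (θ ω) (fun a => e a ω) (fun a => s a ω) x) := by
  refine measurable_of_finite_index
    (g := fun S ω => perturbedMax S (fun a => e a ω) (fun a => s a ω) x) hθ fun S => ?_
  by_cases h : S.Nonempty
  · simp only [perturbedMax, dif_pos h]
    have := Finset.measurable_sup' h (f := fun B ω => ∑ a ∈ B, (e a ω + x * s a ω))
      fun B _ => Finset.measurable_sum _ fun a _ => (he a).add ((hs a).const_mul x)
    convert! this using 1
    ext ω
    rw [Finset.sup'_apply]
  · simp only [perturbedMax, dif_neg h]
    exact measurable_const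

namespace IsCLSGRun

variable {N : ℕ} {I : SemiBandit N} {γ : ℝ} {Ω : Type*} [mΩ : MeasurableSpace Ω]
  {μ : Measure Ω} {𝓕 : Filtration ℕ mΩ} {Θ : ℕ → Ω → Finset (Finset (Fin N))}
  {w : ℕ → Ω → ℝ} {A : ℕ → Ω → Finset (Fin N)} {X : ℕ → Fin N → Ω → ℝ}

theorem measurableSet_mem (h : IsCLSGRun I γ μ 𝓕 Θ w A X) (a : Fin N) (t : ℕ) :
    MeasurableSet[𝓕 (t + 1)] {ω | a ∈ A (t + 1) ω} := by
  have : {ω | a ∈ A (t + 1) ω} = ⋃ B ∈ {B : Finset (Fin N) | a ∈ B}, {ω | A (t + 1) ω = B} := by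
    ext ω; simp
  rw [this]
  exact MeasurableSet.biUnion (Set.to_countable _) fun B _ => h.play_meas t B

theorem measurable_sum_played (h : IsCLSGRun I γ μ 𝓕 Θ w A X) (a : Fin N) (t : ℕ)
    {f : ℕ → Ω → ℝ} (hf : ∀ t, Measurable[𝓕 (t + 1)] (f (t + 1))) :
    Measurable[𝓕 t] (fun ω => ∑ τ ∈ Finset.Ico 1 (t + 1), if a ∈ A τ ω then f τ ω else 0) := by
  refine Finset.measurable_fun_sum _ fun τ hτ => ?_
  obtain ⟨h1, h2⟩ := Finset.mem_Ico.1 hτ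
  obtain ⟨k, rfl⟩ : ∃ k, τ = k + 1 := ⟨τ - 1, by omega⟩
  exact Measurable.ite (𝓕.mono (by omega) _ (h.measurableSet_mem a k))
    ((hf k).mono (𝓕.mono (by omega)) le_rfl) measurable_const

theorem measurable_pulls (h : IsCLSGRun I γ μ 𝓕 Θ w A X) (a : Fin N) (t : ℕ) :
    Measurable[𝓕 t] (fun ω => (pulls (fun τ => A τ ω) a (t + 1) : ℝ)) := by
  simp only [pulls_eq_sum, Nat.cast_sum, Nat.cast_ite, Nat.cast_one, Nat.cast_zero]
  exact h.measurable_sum_played a t (f := fun _ _ => 1) fun _ => measurable_const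

theorem measurable_empMean (h : IsCLSGRun I γ μ 𝓕 Θ w A X) (a : Fin N) (t : ℕ) :
    Measurable[𝓕 t] (fun ω => empMean (fun τ => A τ ω) (fun τ b => X τ b ω) a (t + 1)) := by
  simp only [empMean_eq_sum]
  exact (h.measurable_sum_played a t (f := fun τ => X τ a) fun t => h.reward_meas t a).div
    (h.measurable_pulls a t)

theorem measurable_bonus (h : IsCLSGRun I γ μ 𝓕 Θ w A X) (a : Fin N) (t : ℕ) :
    Measurable[𝓕 t] (fun ω => bonus γ (fun τ => A τ ω) a (t + 1)) := by
  simp only [bonus]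
  exact (measurable_const.div ((h.measurable_pulls a t).add measurable_const)).sqrt

/-- The increment is taken at a deterministic seed `x`, so it depends on the past only and is
independent of the seed drawn next. -/
theorem measurable_perturbedGap (h : IsCLSGRun I γ μ 𝓕 Θ w A X) (x : ℝ) (t : ℕ) :
    Measurable[𝓕 t] (fun ω => perturbedGap (Θ (t + 1) ω)
      (fun a => empMean (fun τ => A τ ω) (fun τ b => X τ b ω) a (t + 1))
      (fun a => bonus γ (fun τ => A τ ω) a (t + 1)) x) :=
  (measurable_perturbedMax (h.avail_meas t) (fun a => h.measurable_empMean a t)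
    (fun a => h.measurable_bonus a t) _).sub
  (measurable_perturbedMax (h.avail_meas t) (fun a => h.measurable_empMean a t)
    (fun a => h.measurable_bonus a t) _)

theorem measurable_sum_bonus (h : IsCLSGRun I γ μ 𝓕 Θ w A X) (t : ℕ) :
    Measurable (fun ω => ∑ a ∈ A (t + 1) ω, bonus γ (fun τ => A τ ω) a (t + 1)) :=
  measurable_of_finite_index (g := fun B ω => ∑ a ∈ B, bonus γ (fun τ => A τ ω) a (t + 1))
    (fun B => 𝓕.le _ _ (h.play_meas t B)) fun _ =>
    Finset.measurable_fun_sum _ fun a _ => (h.measurable_bonus a t).mono (𝓕.le _) le_rfl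

/-! ### Concentration of the empirical means -/

theorem measurable_reward (h : IsCLSGRun I γ μ 𝓕 Θ w A X) (a : Fin N) (t : ℕ) :
    Measurable (X (t + 1) a) := (h.reward_meas t a).mono (𝓕.le _) le_rfl

theorem measurable_seed (h : IsCLSGRun I γ μ 𝓕 Θ w A X) (t : ℕ) : Measurable (w (t + 1)) :=
  (h.seed_meas t).mono (𝓕.le _) le_rfl

theorem ae_reward_mem (h : IsCLSGRun I γ μ 𝓕 Θ w A X) :
    ∀ᵐ ω ∂μ, ∀ a t, X (t + 1) a ω ∈ Set.Icc (0 : ℝ) 1 := by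
  refine ae_all_iff.2 fun a => ae_all_iff.2 fun t => ?_
  refine ae_of_ae_map (h.measurable_reward a t).aemeasurable ?_
  rw [h.reward_law]
  exact I.support a

theorem integral_reward (h : IsCLSGRun I γ μ 𝓕 Θ w A X) (a : Fin N) (t : ℕ) :
    ∫ ω, X (t + 1) a ω ∂μ = I.mean a := by
  rw [SemiBandit.mean, ← h.reward_law t a,
    integral_map (h.measurable_reward a t).aemeasurable (by fun_prop)]

/-- Hoeffding's lemma: a variable in `[0, 1]` has variance proxy `1/4`. -/
theorem lintegral_exp_reward_le [IsProbabilityMeasure μ] (h : IsCLSGRun I γ μ 𝓕 Θ w A X)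
    (a : Fin N) (t : ℕ) (l : ℝ) :
    ∫⁻ ω, ENNReal.ofReal (Real.exp (l * (X (t + 1) a ω - I.mean a) - l ^ 2 / 8)) ∂μ ≤ 1 := by
  have hsub := hasSubgaussianMGF_of_mem_Icc (μ := μ) (X := X (t + 1) a) (a := 0) (b := 1)
    (h.measurable_reward a t).aemeasurable
    (h.ae_reward_mem.mono fun ω hω => hω a t)
  rw [h.integral_reward] at hsub
  have hmgf := hsub.mgf_le l
  have hint := hsub.integrable_exp_mul l
  have hfun : ∀ ω, Real.exp (l * (X (t + 1) a ω - I.mean a) - l ^ 2 / 8) =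
      Real.exp (l * (X (t + 1) a ω - I.mean a)) * Real.exp (-(l ^ 2 / 8)) := fun ω => by
    rw [← Real.exp_add]; ring_nf
  simp only [hfun]
  rw [← ofReal_integral_eq_lintegral_ofReal (hint.mul_const _)
    (Filter.Eventually.of_forall fun ω => by positivity), integral_mul_const]
  rw [mgf] at hmgf
  refine ENNReal.ofReal_le_one.2 ?_
  refine (mul_le_mul_of_nonneg_right hmgf (Real.exp_nonneg _)).trans ?_
  rw [← Real.exp_add, Real.exp_le_one_iff]
  simp only [sub_zero, nnnorm_one]
  push_cast
  linarith

theorem measurable_deviation (h : IsCLSGRun I γ μ 𝓕 Θ w A X) (a : Fin N) (t : ℕ) :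
    Measurable[𝓕 t] (deviation I A X a t) :=
  h.measurable_sum_played a t (f := fun τ ω => X τ a ω - I.mean a)
    fun t => (h.reward_meas t a).sub measurable_const

/-- The exponential supermartingale of the deviations has expectation at most one. -/
theorem lintegral_exp_deviation_le [IsProbabilityMeasure μ] (h : IsCLSGRun I γ μ 𝓕 Θ w A X)
    (a : Fin N) (l : ℝ) (t : ℕ) :
    ∫⁻ ω, ENNReal.ofReal (Real.exp (l * deviation I A X a t ω -
      l ^ 2 / 8 * pulls (fun τ => A τ ω) a (t + 1))) ∂μ ≤ 1 := by
  induction t with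
  | zero => simp [deviation, pulls_of_le_one]
  | succ t ih =>
    set M : Ω → ENNReal := fun ω => ENNReal.ofReal (Real.exp (l * deviation I A X a t ω -
      l ^ 2 / 8 * pulls (fun τ => A τ ω) a (t + 1))) with hM
    set Y : Ω → ENNReal := fun ω =>
      ENNReal.ofReal (Real.exp (l * (X (t + 1) a ω - I.mean a) - l ^ 2 / 8)) with hY
    set P : Set Ω := {ω | a ∈ A (t + 1) ω} with hP
    have hMm : Measurable[𝓕 t] M := by
      have h1 := h.measurable_deviation a t
      have h2 := h.measurable_pulls a t
      exact (((h1.const_mul l).sub (h2.const_mul _)).exp).ennreal_ofReal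
    have hPm : MeasurableSet P := 𝓕.le _ _ (h.measurableSet_mem a t)
    have hM' : Measurable M := hMm.mono (𝓕.le _) le_rfl
    have hYm : Measurable Y :=
      ((((h.measurable_reward a t).sub_const _).const_mul l).sub_const _).exp.ennreal_ofReal
    -- Whether `a` is played is decided before its reward is drawn: `P` lies in the σ-algebra from
    -- which the new reward is independent.
    have hind : ∫⁻ ω, P.indicator M ω * Y ω ∂μ = (∫⁻ ω, P.indicator M ω ∂μ) * ∫⁻ ω, Y ω ∂μ := by
      refine lintegral_mul_eq_lintegral_mul_lintegral_of_independent_measurableSpace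
        ?_ ?_ (h.reward_indep t).symm ?_ ?_
      · refine sup_le (sup_le (𝓕.le _) (h.measurable_seed t).comap_le) ?_
        rintro _ ⟨s, -, rfl⟩
        have : A (t + 1) ⁻¹' s = ⋃ B ∈ s, {ω | A (t + 1) ω = B} := by ext ω; simp
        rw [this]
        exact MeasurableSet.biUnion (Set.to_countable _) fun B _ => 𝓕.le _ _ (h.play_meas t B)
      · exact (measurable_pi_lambda _ fun b => h.measurable_reward b t).comap_le
      · refine (hMm.mono (le_sup_of_le_left le_sup_left) le_rfl).indicator ?_
        exact (le_sup_right : MeasurableSpace.comap (A (t + 1)) ⊤ ≤ _) _ ⟨{B | a ∈ B}, trivial, rfl⟩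
      · have hX : Measurable[MeasurableSpace.comap (fun ω a => X (t + 1) a ω) inferInstance]
            (X (t + 1) a) :=
          (measurable_pi_apply a).comp (comap_measurable (fun ω a => X (t + 1) a ω))
        exact (((hX.sub_const _).const_mul l).sub_const _).exp.ennreal_ofReal
    -- Off `P` neither the deviation nor the count changes.
    have hsplit : ∀ ω, ENNReal.ofReal (Real.exp (l * deviation I A X a (t + 1) ω -
        l ^ 2 / 8 * pulls (fun τ => A τ ω) a (t + 1 + 1))) =
        P.indicator M ω * Y ω + Pᶜ.indicator M ω := by
      intro ω
      rw [deviation_succ, pulls_add_two]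
      by_cases hω : a ∈ A (t + 1) ω
      · have h1 : ω ∈ P := hω
        simp only [hω, if_true, Set.indicator_of_mem h1, hM, hY,
          Set.indicator_of_notMem (Set.notMem_compl_iff.2 h1), add_zero]
        rw [← ENNReal.ofReal_mul (Real.exp_nonneg _), ← Real.exp_add]
        push_cast
        ring_nf
      · have h1 : ω ∉ P := hω
        simp [hω, Set.indicator_of_notMem h1, Set.indicator_of_mem (Set.mem_compl h1), hM]
    calc _ = ∫⁻ ω, (P.indicator M ω * Y ω + Pᶜ.indicator M ω) ∂μ := lintegral_congr hsplit
      _ = (∫⁻ ω, P.indicator M ω ∂μ) * ∫⁻ ω, Y ω ∂μ + ∫⁻ ω, Pᶜ.indicator M ω ∂μ := by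
        rw [lintegral_add_left ((hM'.indicator hPm).fun_mul hYm), hind]
      _ ≤ (∫⁻ ω, P.indicator M ω ∂μ) * 1 + ∫⁻ ω, Pᶜ.indicator M ω ∂μ := by
        gcongr
        exact h.lintegral_exp_reward_le a t l
      _ = ∫⁻ ω, M ω ∂μ := by
        rw [mul_one, lintegral_indicator hPm, lintegral_indicator hPm.compl,
          lintegral_add_compl _ hPm]
      _ ≤ 1 := ih

theorem measure_exponent_ge_le [IsProbabilityMeasure μ] (h : IsCLSGRun I γ μ 𝓕 Θ w A X)
    (a : Fin N) (t : ℕ) (l y : ℝ) :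
    μ {ω | y ≤ l * deviation I A X a t ω - l ^ 2 / 8 * pulls (fun τ => A τ ω) a (t + 1)} ≤
      ENNReal.ofReal (Real.exp (-y)) := by
  have h1 := (h.measurable_deviation a t).mono (𝓕.le _) le_rfl
  have h2 := (h.measurable_pulls a t).mono (𝓕.le _) le_rfl
  have hm : Measurable fun ω => ENNReal.ofReal (Real.exp (l * deviation I A X a t ω -
      l ^ 2 / 8 * pulls (fun τ => A τ ω) a (t + 1))) :=
    (((h1.const_mul l).sub (h2.const_mul _)).exp).ennreal_ofReal
  have h3 := mul_meas_ge_le_lintegral (μ := μ) hm (ENNReal.ofReal (Real.exp y))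
  have h4 := h3.trans (h.lintegral_exp_deviation_le a l t)
  have h5 : {ω | y ≤ l * deviation I A X a t ω - l ^ 2 / 8 * pulls (fun τ => A τ ω) a (t + 1)} =
      {ω | ENNReal.ofReal (Real.exp y) ≤ ENNReal.ofReal (Real.exp (l * deviation I A X a t ω -
      l ^ 2 / 8 * pulls (fun τ => A τ ω) a (t + 1)))} := by
    ext ω
    simp only [Set.mem_ofPred_eq]
    rw [ENNReal.ofReal_le_ofReal_iff (Real.exp_nonneg _), Real.exp_le_exp]
  rw [h5, Real.exp_neg, ENNReal.ofReal_inv_of_pos (Real.exp_pos _)]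
  rwa [← one_div, ENNReal.le_div_iff_mul_le (Or.inl (by simp [Real.exp_pos]))
    (Or.inl ENNReal.ofReal_ne_top), mul_comm]

/-- The count is random, so it is pinned to `n` to let the exponent `l = ±4x/n` be deterministic.
This choice maximizes `|l| x - l² n / 8`, with value `2x²/n`. -/
theorem measure_deviation_ge_le [IsProbabilityMeasure μ] (h : IsCLSGRun I γ μ 𝓕 Θ w A X)
    (a : Fin N) (t : ℕ) {n : ℕ} (hn : n ≠ 0) {x : ℝ} (hx : 0 ≤ x) :
    μ {ω | pulls (fun τ => A τ ω) a (t + 1) = n ∧ x ≤ |deviation I A X a t ω|} ≤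
      2 * ENNReal.ofReal (Real.exp (-(2 * x ^ 2 / n))) := by
  have hn' : (0 : ℝ) < n := by exact_mod_cast Nat.pos_of_ne_zero hn
  have hl : 0 ≤ 4 * x / n := by positivity
  rw [two_mul]
  refine le_trans (measure_mono ?_) ((measure_union_le _ _).trans (add_le_add
    (h.measure_exponent_ge_le a t (4 * x / n) (2 * x ^ 2 / n))
    (h.measure_exponent_ge_le a t (-(4 * x / n)) (2 * x ^ 2 / n))))
  rintro ω ⟨h1, h2⟩
  have h3 : 4 * x / n * x - (4 * x / n) ^ 2 / 8 * n = 2 * x ^ 2 / n := by field_simp; ring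
  rcases le_abs'.1 h2 with h4 | h4
  · right
    simp only [Set.mem_ofPred_eq, h1, neg_sq]
    have := mul_le_mul_of_nonneg_left h4 hl
    linarith
  · left
    simp only [Set.mem_ofPred_eq, h1]
    have := mul_le_mul_of_nonneg_left h4 hl
    linarith

end IsCLSGRun

theorem SemiBandit.mean_mem_Icc {N : ℕ} (I : SemiBandit N) (a : Fin N) :
    I.mean a ∈ Set.Icc (0 : ℝ) 1 := by
  have := I.isProb a
  constructor
  · exact integral_nonneg_of_ae ((I.support a).mono fun x hx => hx.1)
  · have h1 : Integrable (fun x : ℝ => x) (I.law a) :=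
      Integrable.of_mem_Icc 0 1 measurable_id.aemeasurable (I.support a)
    refine (integral_mono_ae h1 (integrable_const 1) ((I.support a).mono fun x hx => hx.2)).trans ?_
    simp

namespace IsCLSGRun

variable {N : ℕ} {I : SemiBandit N} {γ : ℝ} {Ω : Type*} [mΩ : MeasurableSpace Ω]
  {μ : Measure Ω} {𝓕 : Filtration ℕ mΩ} {Θ : ℕ → Ω → Finset (Finset (Fin N))}
  {w : ℕ → Ω → ℝ} {A : ℕ → Ω → Finset (Fin N)} {X : ℕ → Fin N → Ω → ℝ}

/-- The outcomes on which the estimate of `a` in round `t` deviates from its mean too much. -/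
def badEvent (I : SemiBandit N) (γ : ℝ) (A : ℕ → Ω → Finset (Fin N)) (X : ℕ → Fin N → Ω → ℝ)
    (a : Fin N) (t : ℕ) : Set Ω :=
  {ω | Real.sqrt (3 / γ) * bonus γ (fun τ => A τ ω) a t <
    |empMean (fun τ => A τ ω) (fun τ b => X τ b ω) a t - I.mean a|}

/-- Union bound over the at most `t` positive values of the count. The factor `√(3/γ)` cancels `γ`
and gives the exponent `6 ln(t+1) · n/(n+1) ≥ 3 ln(t+1)`, so each value contributes at most
`2/(t+1)³`. -/
theorem measureReal_badEvent_le [IsProbabilityMeasure μ] (h : IsCLSGRun I γ μ 𝓕 Θ w A X)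
    (hγ : 0 < γ) (a : Fin N) (t : ℕ) :
    μ.real (badEvent I γ A X a (t + 1)) ≤ 2 / ((t : ℝ) + 1) ^ 2 := by
  rcases Nat.eq_zero_or_pos t with rfl | ht
  -- In round 1 the bonus vanishes because `ln 1 = 0`; the claimed bound is 2 and hence trivial.
  · exact measureReal_le_one.trans (by norm_num)
  have hlog : 0 < Real.log ((t + 1 : ℕ) : ℝ) :=
    Real.log_pos (by exact_mod_cast Nat.lt_add_of_pos_left ht)
  have hb : ∀ n : ℝ, 0 ≤ n → Real.sqrt (3 / γ) *
      Real.sqrt (γ * Real.log ((t + 1 : ℕ) : ℝ) / (n + 1)) =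
      Real.sqrt (3 * Real.log ((t + 1 : ℕ) : ℝ) / (n + 1)) := by
    intro n hn
    rw [← Real.sqrt_mul (by positivity)]
    congr 1
    field_simp
  set x : ℕ → ℝ := fun n => n * Real.sqrt (3 * Real.log ((t + 1 : ℕ) : ℝ) / (n + 1)) with hx
  have hsub : badEvent I γ A X a (t + 1) ⊆ ⋃ n ∈ Finset.Icc 1 t,
      {ω | pulls (fun τ => A τ ω) a (t + 1) = n ∧ x n ≤ |deviation I A X a t ω|} := by
    intro ω hω
    rw [badEvent, Set.mem_ofPred_eq, bonus, hb _ (Nat.cast_nonneg _)] at hω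
    -- An unplayed arm is never bad: its error is at most 1, while the threshold is at least `√(3 ln
    -- 2) > 1`.
    have hn0 : pulls (fun τ => A τ ω) a (t + 1) ≠ 0 := by
      intro h0
      rw [empMean, h0] at hω
      simp only [Nat.cast_zero, div_zero, zero_sub, abs_neg, zero_add, div_one] at hω
      have h1 : |I.mean a| ≤ 1 := by
        rw [abs_of_nonneg (I.mean_mem_Icc a).1]; exact (I.mean_mem_Icc a).2
      have h2 : Real.log 2 ≤ Real.log ((t + 1 : ℕ) : ℝ) :=
        Real.log_le_log (by norm_num) (by exact_mod_cast Nat.succ_le_succ ht)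
      have h3 : (1 : ℝ) ≤ Real.sqrt (3 * Real.log ((t + 1 : ℕ) : ℝ)) := by
        rw [Real.one_le_sqrt]
        linarith [Real.log_two_gt_d9]
      linarith
    simp only [Set.mem_iUnion]
    refine ⟨_, Finset.mem_Icc.2 ⟨Nat.pos_of_ne_zero hn0, pulls_succ_le _ a t⟩, rfl, ?_⟩
    rw [deviation_eq a t ω hn0, abs_mul, Nat.abs_cast]
    exact mul_le_mul_of_nonneg_left hω.le (Nat.cast_nonneg _)
  have hterm : ∀ n ∈ Finset.Icc 1 t,
      μ {ω | pulls (fun τ => A τ ω) a (t + 1) = n ∧ x n ≤ |deviation I A X a t ω|} ≤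
      ENNReal.ofReal (2 / ((t : ℝ) + 1) ^ 3) := by
    intro n hn
    have hn1 : 1 ≤ n := (Finset.mem_Icc.1 hn).1
    have hn' : (1 : ℝ) ≤ n := by exact_mod_cast hn1
    refine (h.measure_deviation_ge_le a t (by omega) (by positivity)).trans ?_
    rw [← ENNReal.ofReal_ofNat, ← ENNReal.ofReal_mul (by norm_num)]
    refine ENNReal.ofReal_le_ofReal ?_
    rw [div_eq_mul_inv]
    refine mul_le_mul_of_nonneg_left ?_ (by norm_num)
    have h1 : 2 * x n ^ 2 / n = 6 * Real.log ((t + 1 : ℕ) : ℝ) * (n / (n + 1)) := by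
      rw [hx]
      simp only
      rw [mul_pow, Real.sq_sqrt (by positivity)]
      field_simp
      ring
    have h2 : (1 / 2 : ℝ) ≤ n / (n + 1) := by
      rw [div_le_div_iff₀ (by norm_num) (by positivity)]; linarith
    have h3 : 3 * Real.log ((t + 1 : ℕ) : ℝ) ≤ 2 * x n ^ 2 / n := by
      rw [h1]; nlinarith
    calc Real.exp (-(2 * x n ^ 2 / n)) ≤ Real.exp (-(3 * Real.log ((t + 1 : ℕ) : ℝ))) :=
          Real.exp_le_exp.2 (by linarith)
      _ = _ := by
          rw [Real.exp_neg, mul_comm, Real.exp_mul, Real.exp_log (by positivity)]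
          norm_cast
  refine ENNReal.toReal_le_of_le_ofReal (by positivity) ?_
  refine (measure_mono hsub).trans ((measure_biUnion_finset_le _ _).trans
    ((Finset.sum_le_sum hterm).trans ?_))
  rw [Finset.sum_const, Nat.card_Icc, Nat.add_sub_cancel, nsmul_eq_mul,
    ← ENNReal.ofReal_natCast, ← ENNReal.ofReal_mul (Nat.cast_nonneg _)]
  refine ENNReal.ofReal_le_ofReal ?_
  rw [mul_div_assoc', div_le_div_iff₀ (by positivity) (by positivity)]
  have : (0 : ℝ) ≤ t := Nat.cast_nonneg t
  nlinarith [pow_pos (by linarith : (0 : ℝ) < t + 1) 2]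

end IsCLSGRun

/-! ### Upper bound -/

theorem SemiBandit.exists_optValue_eq {N : ℕ} (I : SemiBandit N) {S : Finset (Finset (Fin N))}
    (h : S.Nonempty) : ∃ B ∈ S, I.optValue S = I.value B := by
  rw [SemiBandit.optValue, dif_pos h]
  exact Finset.exists_mem_eq_sup' h _

theorem SemiBandit.value_le_optValue {N : ℕ} (I : SemiBandit N) {S : Finset (Finset (Fin N))}
    {B : Finset (Fin N)} (h : B ∈ S) : I.value B ≤ I.optValue S := by
  rw [SemiBandit.optValue, dif_pos ⟨B, h⟩]
  exact Finset.le_sup' _ h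

theorem SemiBandit.value_nonneg {N : ℕ} (I : SemiBandit N) (B : Finset (Fin N)) :
    0 ≤ I.value B := Finset.sum_nonneg fun a _ => (I.mean_mem_Icc a).1

theorem SemiBandit.value_le_card {N : ℕ} (I : SemiBandit N) (B : Finset (Fin N)) :
    I.value B ≤ B.card := by
  refine (Finset.sum_le_card_nsmul _ _ 1 fun a _ => (I.mean_mem_Icc a).2).trans ?_
  simp

theorem SemiBandit.card_le_maxCard {N : ℕ} (I : SemiBandit N) {B : Finset (Fin N)}
    (h : B ∈ I.feasible) : B.card ≤ I.maxCard := Finset.le_sup (f := Finset.card) h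

theorem SemiBandit.maxCard_le {N : ℕ} (I : SemiBandit N) : I.maxCard ≤ N :=
  Finset.sup_le fun B _ => (Finset.card_le_univ B).trans (by simp)

theorem regret_eq_sum_range {N : ℕ} (I : SemiBandit N) {Ω : Type*} [MeasurableSpace Ω]
    (μ : Measure Ω) (Θ : ℕ → Ω → Finset (Finset (Fin N))) (A : ℕ → Ω → Finset (Fin N)) (T : ℕ) :
    regret I μ Θ A T =
      ∑ t ∈ Finset.range T, ∫ ω, (I.optValue (Θ (t + 1) ω) - I.value (A (t + 1) ω)) ∂μ := by
  rw [regret]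
  induction T with
  | zero => simp
  | succ T ih => rw [Finset.sum_Icc_succ_top (by omega), ih, Finset.sum_range_succ]

theorem sum_inv_sq_le (T : ℕ) : ∑ t ∈ Finset.range T, 1 / ((t : ℝ) + 1) ^ 2 ≤ 2 := by
  -- The strengthened bound telescopes; at `T = 0` it uses `1 / 0 = 0`.
  suffices h : ∑ t ∈ Finset.range T, 1 / ((t : ℝ) + 1) ^ 2 ≤ 2 - 1 / (T : ℝ) from
    h.trans (sub_le_self _ (by positivity))
  induction T with
  | zero => simp
  | succ T ih =>
    rw [Finset.sum_range_succ]
    rcases Nat.eq_zero_or_pos T with rfl | hT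
    · norm_num
    have hT' : (0 : ℝ) < T := by exact_mod_cast hT
    have : 1 / ((T : ℝ) + 1) ^ 2 ≤ 1 / T - 1 / (T + 1) := by
      rw [div_sub_div _ _ hT'.ne' (by positivity), div_le_div_iff₀ (by positivity) (by positivity)]
      nlinarith
    push_cast
    linarith

theorem sum_bonus_le {N : ℕ} {γ : ℝ} (hγ : 0 < γ) (B : Finset (Fin N))
    (C : ℕ → Finset (Fin N)) (t : ℕ) :
    ∑ a ∈ B, bonus γ C a t ≤ N * Real.sqrt (γ * Real.log t) := by
  refine (Finset.sum_le_sum_of_subset_of_nonneg (Finset.subset_univ B)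
    fun a _ _ => bonus_nonneg γ C a t).trans ?_
  refine (Finset.sum_le_card_nsmul _ _ _ fun a _ => bonus_le hγ C a t).trans ?_
  simp

/-! ### Moments of the seed and the expected increment of the perturbed maximum -/

namespace IsCLSGRun

variable {N : ℕ} {I : SemiBandit N} {γ : ℝ} {Ω : Type*} [mΩ : MeasurableSpace Ω]
  {μ : Measure Ω} {𝓕 : Filtration ℕ mΩ} {Θ : ℕ → Ω → Finset (Finset (Fin N))}
  {w : ℕ → Ω → ℝ} {A : ℕ → Ω → Finset (Fin N)} {X : ℕ → Fin N → Ω → ℝ}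

theorem integrable_sq_seed (h : IsCLSGRun I γ μ 𝓕 Θ w A X) (t : ℕ) :
    Integrable (fun ω => w (t + 1) ω ^ 2) μ := by
  have h1 : Integrable (fun x : ℝ => x ^ 2) (μ.map (w (t + 1))) := by
    rw [h.seed_law]
    exact (memLp_id_gaussianReal' 2 (by simp)).integrable_sq
  exact h1.comp_measurable (h.measurable_seed t)

theorem integrable_abs_seed (h : IsCLSGRun I γ μ 𝓕 Θ w A X) (t : ℕ) :
    Integrable (fun ω => |w (t + 1) ω|) μ := by
  have h1 : Integrable (fun x : ℝ => |x|) (μ.map (w (t + 1))) := by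
    rw [h.seed_law]
    exact ((memLp_id_gaussianReal' 1 (by simp)).integrable le_rfl).abs
  exact h1.comp_measurable (h.measurable_seed t)

theorem integral_sq_seed (h : IsCLSGRun I γ μ 𝓕 Θ w A X) (t : ℕ) :
    ∫ ω, w (t + 1) ω ^ 2 ∂μ = 1 := by
  have h1 : ∫ ω, w (t + 1) ω ^ 2 ∂μ = ∫ x, x ^ 2 ∂(gaussianReal 0 1) := by
    rw [← h.seed_law t, integral_map (h.measurable_seed t).aemeasurable (by fun_prop)]
  rw [h1]
  have h2 := variance_id_gaussianReal (μ := 0) (v := 1)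
  rw [variance_eq_integral (by fun_prop)] at h2
  simpa using h2

theorem integral_abs_seed_le [IsProbabilityMeasure μ] (h : IsCLSGRun I γ μ 𝓕 Θ w A X) (t : ℕ) :
    ∫ ω, |w (t + 1) ω| ∂μ ≤ 1 := by
  have h1 : ∫ ω, |w (t + 1) ω| ∂μ ≤ ∫ ω, (w (t + 1) ω ^ 2 + 1) / 2 ∂μ := by
    refine integral_mono (h.integrable_abs_seed t)
      (((h.integrable_sq_seed t).add (integrable_const 1)).div_const 2) fun ω => ?_
    have := sq_nonneg (|w (t + 1) ω| - 1)
    simp only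
    rw [← sq_abs (w (t + 1) ω)]
    linarith
  rw [integral_div, integral_add (h.integrable_sq_seed t) (integrable_const 1),
    h.integral_sq_seed] at h1
  simpa using h1

theorem indepFun_seed (h : IsCLSGRun I γ μ 𝓕 Θ w A X) (t : ℕ) {f g : Ω → ℝ}
    (hf : Measurable[MeasurableSpace.comap (w (t + 1)) inferInstance] f)
    (hg : Measurable[𝓕 t] g) : IndepFun f g μ :=
  indep_of_indep_of_le_left (indep_of_indep_of_le_right (h.seed_indep t) hg.comap_le) hf.comap_le

/-- The expected increment of the perturbed maximum is controlled by the bonus of the played super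
arm, because a large seed is drawn with constant probability, independently of the past. -/
theorem integral_perturbedGap_le [IsProbabilityMeasure μ] (h : IsCLSGRun I γ μ 𝓕 Θ w A X)
    (hγ : 0 < γ) (x : ℝ) (t : ℕ) :
    (gaussianReal 0 1).real (Set.Ioi (x + 1)) * ∫ ω, perturbedGap (Θ (t + 1) ω)
      (fun a => empMean (fun τ => A τ ω) (fun τ b => X τ b ω) a (t + 1))
      (fun a => bonus γ (fun τ => A τ ω) a (t + 1)) x ∂μ ≤
    ∫ ω, ∑ a ∈ A (t + 1) ω, bonus γ (fun τ => A τ ω) a (t + 1) ∂μ := by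
  set G : Ω → ℝ := fun ω => perturbedGap (Θ (t + 1) ω)
      (fun a => empMean (fun τ => A τ ω) (fun τ b => X τ b ω) a (t + 1))
      (fun a => bonus γ (fun τ => A τ ω) a (t + 1)) x with hG
  set f : Ω → ℝ := fun ω => (Set.Ioi (x + 1)).indicator 1 (w (t + 1) ω) with hf
  have hfm : Measurable[MeasurableSpace.comap (w (t + 1)) inferInstance] f :=
    (measurable_one.indicator measurableSet_Ioi).comp (comap_measurable (w (t + 1)))
  have hGm : Measurable[𝓕 t] G := h.measurable_perturbedGap x t
  have hind := h.indepFun_seed t hfm hGm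
  have hfm' : Measurable f := hfm.mono (h.measurable_seed t).comap_le le_rfl
  have hGm' : Measurable G := hGm.mono (𝓕.le t) le_rfl
  have hfi : ∫ ω, f ω ∂μ = (gaussianReal 0 1).real (Set.Ioi (x + 1)) := by
    rw [← h.seed_law t, ← integral_indicator_one measurableSet_Ioi,
      integral_map (h.measurable_seed t).aemeasurable
        (measurable_one.indicator measurableSet_Ioi).aestronglyMeasurable]
  rw [← hfi, ← hind.integral_fun_mul_eq_mul_integral hfm'.aestronglyMeasurable
    hGm'.aestronglyMeasurable]
  have hG0 : ∀ ω, 0 ≤ G ω := fun ω =>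
    perturbedGap_nonneg (h.avail_nonempty t ω) _ (fun a => bonus_nonneg _ _ a _) x
  refine integral_mono_of_nonneg (Filter.Eventually.of_forall fun ω => mul_nonneg
    (Set.indicator_nonneg (fun _ _ => zero_le_one) _) (hG0 ω)) ?_
    (Filter.Eventually.of_forall fun ω => ?_)
  · refine Integrable.of_bound (h.measurable_sum_bonus t).aestronglyMeasurable
      (N * Real.sqrt (γ * Real.log ((t + 1 : ℕ) : ℝ))) (Filter.Eventually.of_forall fun ω => ?_)
    rw [Real.norm_of_nonneg (Finset.sum_nonneg fun a _ => bonus_nonneg _ _ a _)]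
    exact sum_bonus_le hγ _ _ _
  · have hs : 0 ≤ ∑ a ∈ A (t + 1) ω, bonus γ (fun τ => A τ ω) a (t + 1) :=
      Finset.sum_nonneg fun a _ => bonus_nonneg _ _ a _
    by_cases hw : x + 1 < w (t + 1) ω
    · simp only [hf, Set.indicator_of_mem (Set.mem_Ioi.2 hw), Pi.one_apply, one_mul]
      exact perturbedGap_le _ _ hw (h.play_mem t ω) (h.play_max t ω)
    · simp only [hf, Set.indicator_of_notMem (fun hlt => hw (Set.mem_Ioi.1 hlt)), zero_mul]
      exact hs

end IsCLSGRun

/-- The factor of the played bonus in the bound for the regret of one round. -/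
noncomputable def regretFactor (γ : ℝ) : ℝ :=
  Real.sqrt (3 / γ) + (Real.sqrt (3 / γ) + 1) /
    (gaussianReal 0 1).real (Set.Ioi (Real.sqrt (3 / γ) + 1))

theorem gaussianReal_real_Ioi_pos (x : ℝ) : 0 < (gaussianReal 0 1).real (Set.Ioi x) := by
  refine ENNReal.toReal_pos (fun h0 => ?_) (measure_ne_top _ _)
  have h1 := gaussianReal_absolutelyContinuous' 0 (one_ne_zero : (1 : NNReal) ≠ 0) h0
  simp at h1

/-! ### Regret of one round and its summation -/

namespace IsCLSGRun

variable {N : ℕ} {I : SemiBandit N} {γ : ℝ} {Ω : Type*} [mΩ : MeasurableSpace Ω]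
  {μ : Measure Ω} {𝓕 : Filtration ℕ mΩ} {Θ : ℕ → Ω → Finset (Finset (Fin N))}
  {w : ℕ → Ω → ℝ} {A : ℕ → Ω → Finset (Fin N)} {X : ℕ → Fin N → Ω → ℝ}

theorem measurableSet_badEvent (h : IsCLSGRun I γ μ 𝓕 Θ w A X) (a : Fin N) (t : ℕ) :
    MeasurableSet (badEvent I γ A X a (t + 1)) := by
  have h1 := (h.measurable_bonus a t).mono (𝓕.le _) le_rfl
  have h2 := (h.measurable_empMean a t).mono (𝓕.le _) le_rfl
  exact measurableSet_lt (h1.const_mul _) (h2.sub_const _).abs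

/-- `sum_sub_sum_le` with `ξ` the indicator of the bad event, which suffices because both the
estimate and the mean lie in `[0, 1]`. -/
theorem optValue_sub_value_le (h : IsCLSGRun I γ μ 𝓕 Θ w A X) (t : ℕ) :
    ∀ᵐ ω ∂μ, I.optValue (Θ (t + 1) ω) - I.value (A (t + 1) ω) ≤
      (|w (t + 1) ω| + Real.sqrt (3 / γ)) *
        ∑ a ∈ A (t + 1) ω, bonus γ (fun τ => A τ ω) a (t + 1) +
      max (Real.sqrt (3 / γ) - w (t + 1) ω) 0 * perturbedGap (Θ (t + 1) ω)
        (fun a => empMean (fun τ => A τ ω) (fun τ b => X τ b ω) a (t + 1))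
        (fun a => bonus γ (fun τ => A τ ω) a (t + 1)) (Real.sqrt (3 / γ)) +
      2 * ∑ a, (badEvent I γ A X a (t + 1)).indicator 1 ω := by
  filter_upwards [h.ae_reward_mem] with ω hω
  obtain ⟨B, hB, hBv⟩ := I.exists_optValue_eq (h.avail_nonempty t ω)
  rw [hBv]
  refine sum_sub_sum_le (fun a => bonus_nonneg _ _ a _)
    (fun a => Set.indicator_nonneg (fun _ _ => zero_le_one) _) (fun a => ?_)
    (h.play_mem t ω) hB (h.play_max t ω)
  by_cases hb : ω ∈ badEvent I γ A X a (t + 1)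
  · simp only [Set.indicator_of_mem hb]
    have h1 := empMean_mem_Icc (A := fun τ => A τ ω) (X := fun τ b => X τ b ω) (hω a) (t + 1)
    have h2 := I.mean_mem_Icc a
    have h3 : 0 ≤ Real.sqrt (3 / γ) * bonus γ (fun τ => A τ ω) a (t + 1) :=
      mul_nonneg (Real.sqrt_nonneg _) (bonus_nonneg _ _ _ _)
    rw [abs_le]
    constructor <;> linarith [h1.1, h1.2, h2.1, h2.2]
  · rw [Set.indicator_of_notMem hb, add_zero]
    exact not_lt.1 hb

theorem integrable_mul_sum_bonus (h : IsCLSGRun I γ μ 𝓕 Θ w A X) (hγ : 0 < γ) (t : ℕ)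
    {f : Ω → ℝ} (hf : Integrable f μ) :
    Integrable (fun ω => f ω * ∑ a ∈ A (t + 1) ω, bonus γ (fun τ => A τ ω) a (t + 1)) μ := by
  refine hf.mul_bdd (c := N * Real.sqrt (γ * Real.log ((t + 1 : ℕ) : ℝ)))
    (h.measurable_sum_bonus t).aestronglyMeasurable (Filter.Eventually.of_forall fun ω => ?_)
  rw [Real.norm_of_nonneg (Finset.sum_nonneg fun a _ => bonus_nonneg _ _ a _)]
  exact sum_bonus_le hγ _ _ _

theorem integrable_mul_perturbedGap (h : IsCLSGRun I γ μ 𝓕 Θ w A X) (hγ : 0 < γ) (x : ℝ) (t : ℕ)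
    {f : Ω → ℝ} (hf : Integrable f μ) :
    Integrable (fun ω => f ω * perturbedGap (Θ (t + 1) ω)
        (fun a => empMean (fun τ => A τ ω) (fun τ b => X τ b ω) a (t + 1))
        (fun a => bonus γ (fun τ => A τ ω) a (t + 1)) x) μ := by
  refine hf.mul_bdd (c := N * Real.sqrt (γ * Real.log ((t + 1 : ℕ) : ℝ)))
    ((h.measurable_perturbedGap x t).mono (𝓕.le t) le_rfl).aestronglyMeasurable
    (Filter.Eventually.of_forall fun ω => ?_)
  rw [Real.norm_of_nonneg (perturbedGap_nonneg (h.avail_nonempty t ω) _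
    (fun a => bonus_nonneg _ _ a _) x)]
  exact (perturbedGap_le_sum (h.avail_nonempty t ω) _ (fun a => bonus_nonneg _ _ a _) x).trans
    (sum_bonus_le hγ _ _ _)

/-- Independence splits off the shortfall `max (K - w) 0`, of mean at most `K + 1`, and the expected
increment is then paid for by the played bonus. `regretFactor` collects the resulting constants. -/
theorem integral_optValue_sub_value_le [IsProbabilityMeasure μ] (h : IsCLSGRun I γ μ 𝓕 Θ w A X)
    (hγ : 0 < γ) (t : ℕ) :
    ∫ ω, (I.optValue (Θ (t + 1) ω) - I.value (A (t + 1) ω)) ∂μ ≤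
      ∫ ω, (|w (t + 1) ω| + regretFactor γ) *
        ∑ a ∈ A (t + 1) ω, bonus γ (fun τ => A τ ω) a (t + 1) ∂μ +
      4 * N * (1 / ((t : ℝ) + 1) ^ 2) := by
  set K := Real.sqrt (3 / γ) with hK
  have hK0 : 0 ≤ K := Real.sqrt_nonneg _
  set σ : Ω → ℝ := fun ω => ∑ a ∈ A (t + 1) ω, bonus γ (fun τ => A τ ω) a (t + 1) with hσ
  set G : Ω → ℝ := fun ω => perturbedGap (Θ (t + 1) ω)
      (fun a => empMean (fun τ => A τ ω) (fun τ b => X τ b ω) a (t + 1))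
      (fun a => bonus γ (fun τ => A τ ω) a (t + 1)) K with hG
  have hw := h.measurable_seed t
  have hiw := h.integrable_abs_seed t
  have hmax : Integrable (fun ω => max (K - w (t + 1) ω) 0) μ := by
    refine (hiw.add (integrable_const K)).mono' (by fun_prop)
      (Filter.Eventually.of_forall fun ω => ?_)
    rw [Real.norm_of_nonneg (le_max_right _ _)]
    refine max_le ?_ (by simp only [Pi.add_apply]; positivity)
    simp only [Pi.add_apply]
    linarith [neg_abs_le (w (t + 1) ω)]
  have hmax_le : ∫ ω, max (K - w (t + 1) ω) 0 ∂μ ≤ K + 1 := by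
    have h1 : ∫ ω, max (K - w (t + 1) ω) 0 ∂μ ≤ ∫ ω, (|w (t + 1) ω| + K) ∂μ := by
      refine integral_mono hmax (hiw.add (integrable_const K)) fun ω => ?_
      refine max_le ?_ (by positivity)
      linarith [neg_abs_le (w (t + 1) ω)]
    rw [integral_add hiw (integrable_const K)] at h1
    have := h.integral_abs_seed_le t
    simp only [integral_const, probReal_univ, smul_eq_mul, one_mul] at h1
    linarith
  have i1 : Integrable (fun ω => (|w (t + 1) ω| + K) * σ ω) μ :=
    h.integrable_mul_sum_bonus hγ t (hiw.add (integrable_const K))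
  have i2 : Integrable (fun ω => max (K - w (t + 1) ω) 0 * G ω) μ :=
    h.integrable_mul_perturbedGap hγ K t hmax
  have i3 : ∀ a, Integrable (fun ω => (badEvent I γ A X a (t + 1)).indicator (1 : Ω → ℝ) ω) μ :=
    fun a => (integrable_const (1 : ℝ)).indicator (h.measurableSet_badEvent a t)
  have i3' : Integrable
      (fun ω => 2 * ∑ a, (badEvent I γ A X a (t + 1)).indicator (1 : Ω → ℝ) ω) μ :=
    (integrable_finsetSum _ fun a _ => i3 a).const_mul 2
  have iσ : Integrable σ μ := by
    simpa using h.integrable_mul_sum_bonus hγ t (integrable_const (1 : ℝ))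
  have step : ∫ ω, (I.optValue (Θ (t + 1) ω) - I.value (A (t + 1) ω)) ∂μ ≤
      ∫ ω, ((|w (t + 1) ω| + K) * σ ω + max (K - w (t + 1) ω) 0 * G ω +
        2 * ∑ a, (badEvent I γ A X a (t + 1)).indicator (1 : Ω → ℝ) ω) ∂μ := by
    refine integral_mono_of_nonneg (Filter.Eventually.of_forall fun ω => ?_)
      ((i1.add i2).add i3') (h.optValue_sub_value_le t)
    exact sub_nonneg.2 (I.value_le_optValue (h.play_mem t ω))
  have e1 : ∫ ω, max (K - w (t + 1) ω) 0 * G ω ∂μ =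
      (∫ ω, max (K - w (t + 1) ω) 0 ∂μ) * ∫ ω, G ω ∂μ := by
    have hGm : Measurable[𝓕 t] G := h.measurable_perturbedGap K t
    have hfm : Measurable[MeasurableSpace.comap (w (t + 1)) inferInstance]
        (fun ω => max (K - w (t + 1) ω) 0) :=
      ((measurable_const.sub measurable_id).max measurable_const).comp
        (comap_measurable (w (t + 1)))
    exact (h.indepFun_seed t hfm hGm).integral_fun_mul_eq_mul_integral
      hmax.aestronglyMeasurable (hGm.mono (𝓕.le t) le_rfl).aestronglyMeasurable
  have hp := gaussianReal_real_Ioi_pos (K + 1)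
  have hG_le : ∫ ω, G ω ∂μ ≤ (∫ ω, σ ω ∂μ) / (gaussianReal 0 1).real (Set.Ioi (K + 1)) := by
    rw [le_div_iff₀ hp, mul_comm]
    exact h.integral_perturbedGap_le hγ K t
  have hG0 : 0 ≤ ∫ ω, G ω ∂μ := integral_nonneg fun ω =>
    perturbedGap_nonneg (h.avail_nonempty t ω) _ (fun a => bonus_nonneg _ _ a _) K
  have e2 : ∫ ω, max (K - w (t + 1) ω) 0 * G ω ∂μ ≤
      (K + 1) / (gaussianReal 0 1).real (Set.Ioi (K + 1)) * ∫ ω, σ ω ∂μ := by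
    rw [e1]
    calc _ ≤ (K + 1) * ∫ ω, G ω ∂μ := mul_le_mul_of_nonneg_right hmax_le hG0
      _ ≤ (K + 1) * ((∫ ω, σ ω ∂μ) / (gaussianReal 0 1).real (Set.Ioi (K + 1))) :=
        mul_le_mul_of_nonneg_left hG_le (by linarith)
      _ = _ := by ring
  have e3 : ∫ ω, 2 * ∑ a, (badEvent I γ A X a (t + 1)).indicator (1 : Ω → ℝ) ω ∂μ ≤
      4 * N * (1 / ((t : ℝ) + 1) ^ 2) := by
    rw [integral_const_mul, integral_finsetSum _ fun a _ => i3 a]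
    have : ∑ a : Fin N, ∫ ω, (badEvent I γ A X a (t + 1)).indicator (1 : Ω → ℝ) ω ∂μ ≤
        ∑ _a : Fin N, 2 / ((t : ℝ) + 1) ^ 2 := by
      refine Finset.sum_le_sum fun a _ => ?_
      rw [integral_indicator_one (h.measurableSet_badEvent a t)]
      exact h.measureReal_badEvent_le hγ a t
    rw [Finset.sum_const, Finset.card_univ, Fintype.card_fin, nsmul_eq_mul] at this
    calc _ ≤ 2 * (N * (2 / ((t : ℝ) + 1) ^ 2)) := mul_le_mul_of_nonneg_left this (by norm_num)
      _ = _ := by ring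
  have e4 : ∫ ω, (|w (t + 1) ω| + regretFactor γ) * σ ω ∂μ =
      ∫ ω, (|w (t + 1) ω| + K) * σ ω ∂μ +
      (K + 1) / (gaussianReal 0 1).real (Set.Ioi (K + 1)) * ∫ ω, σ ω ∂μ := by
    rw [← integral_const_mul, ← integral_add i1 (iσ.const_mul _)]
    congr 1
    ext ω
    rw [regretFactor]
    ring
  have i12 : Integrable (fun ω => (|w (t + 1) ω| + K) * σ ω + max (K - w (t + 1) ω) 0 * G ω) μ :=
    i1.add i2
  rw [integral_add i12 i3', integral_add i1 i2] at step
  linarith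

/-- Weighted AM–GM separates the unbounded seed from the played bonus without any independence
between them; `η` is tuned in `regret_le`. -/
theorem regret_le_of_pos [IsProbabilityMeasure μ] (h : IsCLSGRun I γ μ 𝓕 Θ w A X)
    (hγ : 0 < γ) {η : ℝ} (hη : 0 < η) (T : ℕ) :
    regret I μ Θ A T ≤ η * (1 + regretFactor γ ^ 2) * T +
      I.maxCard * (γ * Real.log T) * (N * (1 + Real.log T)) / (2 * η) + 8 * N := by
  set L := regretFactor γ with hL
  set σ : ℕ → Ω → ℝ := fun t ω => ∑ a ∈ A (t + 1) ω, bonus γ (fun τ => A τ ω) a (t + 1) with hσ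
  have iσ2 : ∀ t, Integrable (fun ω => σ t ω ^ 2) μ := fun t => by
    have h1 := h.integrable_mul_sum_bonus hγ t (integrable_const (1 : ℝ))
    have h2 := h.integrable_mul_sum_bonus hγ t h1
    simpa [hσ, sq] using h2
  have hround : ∀ t, ∫ ω, (|w (t + 1) ω| + L) * σ t ω ∂μ ≤
      η * (1 + L ^ 2) + (∫ ω, σ t ω ^ 2 ∂μ) / (2 * η) := by
    intro t
    have i0 := h.integrable_sq_seed t
    have i1 : Integrable (fun ω => η * (w (t + 1) ω ^ 2 + L ^ 2)) μ :=
      (i0.add (integrable_const _)).const_mul η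
    have i2 : Integrable (fun ω => σ t ω ^ 2 / (2 * η)) μ := (iσ2 t).div_const _
    have h1 : ∫ ω, (|w (t + 1) ω| + L) * σ t ω ∂μ ≤
        ∫ ω, (η * (w (t + 1) ω ^ 2 + L ^ 2) + σ t ω ^ 2 / (2 * η)) ∂μ := by
      refine integral_mono (h.integrable_mul_sum_bonus hγ t
        ((h.integrable_abs_seed t).add (integrable_const L))) (i1.add i2) fun ω => ?_
      have h2 : η * (w (t + 1) ω ^ 2 + L ^ 2) + σ t ω ^ 2 / (2 * η) -
          (|w (t + 1) ω| + L) * σ t ω = (η * (|w (t + 1) ω| - L) ^ 2 +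
            (η * (|w (t + 1) ω| + L) - σ t ω) ^ 2 / η) / 2 := by
        rw [← sq_abs (w (t + 1) ω)]
        field_simp
        ring
      have h3 : 0 ≤ (η * (|w (t + 1) ω| - L) ^ 2 +
            (η * (|w (t + 1) ω| + L) - σ t ω) ^ 2 / η) / 2 := by positivity
      simp only
      linarith
    rw [integral_add i1 i2, integral_const_mul, integral_add i0 (integrable_const _),
      h.integral_sq_seed, integral_div] at h1
    simpa using h1
  -- The potential bound holds on every outcome, whatever the availability.
  have hpot : ∑ t ∈ Finset.range T, ∫ ω, σ t ω ^ 2 ∂μ ≤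
      I.maxCard * (γ * Real.log T) * (N * (1 + Real.log T)) := by
    rw [← integral_finsetSum _ fun t _ => iσ2 t]
    refine (integral_mono (integrable_finsetSum _ fun t _ => iσ2 t)
      (integrable_const (I.maxCard * (γ * Real.log T) * (N * (1 + Real.log T))))
      fun ω => ?_).trans (by simp)
    calc ∑ t ∈ Finset.range T, σ t ω ^ 2
        ≤ ∑ t ∈ Finset.range T, I.maxCard * (γ * Real.log T) *
          ∑ a ∈ A (t + 1) ω, 1 / ((pulls (fun τ => A τ ω) a (t + 1) : ℝ) + 1) :=
          Finset.sum_le_sum fun t ht => sq_sum_bonus_le hγ (fun τ => A τ ω)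
            (I.card_le_maxCard (h.avail_subset t ω (h.play_mem t ω))) (by omega)
            (Finset.mem_range.1 ht)
      _ ≤ _ := by
          rw [← Finset.mul_sum]
          have := Real.log_natCast_nonneg T
          exact mul_le_mul_of_nonneg_left (sum_inv_pulls_le (fun τ => A τ ω) T) (by positivity)
  have hN := mul_le_mul_of_nonneg_left (sum_inv_sq_le T) (by positivity : (0 : ℝ) ≤ 4 * N)
  have hpot' := div_le_div_of_nonneg_right hpot (by positivity : 0 ≤ 2 * η)
  rw [regret_eq_sum_range]
  calc _ ≤ ∑ t ∈ Finset.range T, (η * (1 + L ^ 2) + (∫ ω, σ t ω ^ 2 ∂μ) / (2 * η) +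
        4 * N * (1 / ((t : ℝ) + 1) ^ 2)) := Finset.sum_le_sum fun t _ =>
          (h.integral_optValue_sub_value_le hγ t).trans (by linarith [hround t])
    _ = η * (1 + L ^ 2) * T + (∑ t ∈ Finset.range T, ∫ ω, σ t ω ^ 2 ∂μ) / (2 * η) +
        4 * N * ∑ t ∈ Finset.range T, 1 / ((t : ℝ) + 1) ^ 2 := by
          rw [Finset.sum_add_distrib, Finset.sum_add_distrib, ← Finset.sum_div,
            ← Finset.mul_sum (a := (4 * N : ℝ))]
          simp only [Finset.sum_const, Finset.card_range, nsmul_eq_mul]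
          ring
    _ ≤ _ := by linarith

theorem regret_le_maxCard_mul [IsProbabilityMeasure μ] (h : IsCLSGRun I γ μ 𝓕 Θ w A X) (T : ℕ) :
    regret I μ Θ A T ≤ I.maxCard * T := by
  rw [regret_eq_sum_range]
  have : ∀ t, ∫ ω, (I.optValue (Θ (t + 1) ω) - I.value (A (t + 1) ω)) ∂μ ≤ I.maxCard := by
    intro t
    refine (integral_mono_of_nonneg (Filter.Eventually.of_forall fun ω =>
      sub_nonneg.2 (I.value_le_optValue (h.play_mem t ω))) (integrable_const (I.maxCard : ℝ))
      (Filter.Eventually.of_forall fun ω => ?_)).trans (by simp)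
    obtain ⟨B, hB, hBv⟩ := I.exists_optValue_eq (h.avail_nonempty t ω)
    have h1 := I.value_le_card B
    have h2 : (B.card : ℝ) ≤ I.maxCard :=
      by exact_mod_cast I.card_le_maxCard (h.avail_subset t ω hB)
    have h3 := I.value_nonneg (A (t + 1) ω)
    simp only [hBv]
    linarith
  refine (Finset.sum_le_card_nsmul _ _ _ fun t _ => this t).trans ?_
  simp [mul_comm]

/-- Regret of CL-SG against an adaptive availability process. -/
theorem regret_le [IsProbabilityMeasure μ] (h : IsCLSGRun I γ μ 𝓕 Θ w A X) (hγ : 0 < γ)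
    {T : ℕ} (hT : 2 ≤ T) :
    regret I μ Θ A T ≤ (1 + regretFactor γ ^ 2 + 3 / 2 * γ + 16) *
      (Real.log T * Real.sqrt (I.maxCard * N * T)) := by
  have hlog : 1 / 2 ≤ Real.log T := by
    have : Real.log 2 ≤ Real.log T := Real.log_le_log (by norm_num) (by exact_mod_cast hT)
    linarith [Real.log_two_gt_d9]
  have hT' : (0 : ℝ) < T := by exact_mod_cast (by omega : 0 < T)
  set Q := Real.sqrt (I.maxCard * N * T) with hQ
  have hQ0 : 0 ≤ Q := Real.sqrt_nonneg _
  have hQ2 : Q * Q = I.maxCard * N * T := Real.mul_self_sqrt (by positivity)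
  have hmN : (I.maxCard : ℝ) ≤ N := by exact_mod_cast I.maxCard_le
  rcases lt_or_ge ((I.maxCard : ℝ) * T) N with hsmall | hlarge
  -- If `mT < N`, the trivial regret bound `mT` is already below `√(mNT)`.
  · refine (h.regret_le_maxCard_mul T).trans ?_
    have h1 : I.maxCard * T ≤ Q := by
      refine Real.le_sqrt_of_sq_le ?_
      have h2 : (0 : ℝ) ≤ I.maxCard * T := by positivity
      nlinarith
    have h3 : 0 ≤ Real.log T * Q := by positivity
    have h4 : 0 ≤ (regretFactor γ ^ 2 + 3 / 2 * γ + 15) * (Real.log T * Q) := by positivity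
    nlinarith
  rcases Nat.eq_zero_or_pos N with hN0 | hNpos
  · refine (h.regret_le_maxCard_mul T).trans ?_
    have : (I.maxCard : ℝ) = 0 := le_antisymm (by simpa [hN0] using hmN) (Nat.cast_nonneg _)
    rw [this]
    have h3 : 0 ≤ Real.log T * Q := by positivity
    have : 0 ≤ (1 + regretFactor γ ^ 2 + 3 / 2 * γ + 16) * (Real.log T * Q) := by positivity
    linarith
  have hN' : (0 : ℝ) < N := by exact_mod_cast hNpos
  -- Since `mT ≥ N`, the additive term `8N` is absorbed.
  have hNQ : N ≤ Q := by
    refine Real.le_sqrt_of_sq_le ?_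
    nlinarith
  have hQpos : 0 < Q := hN'.trans_le hNQ
  -- This `η` balances the linear and the potential term up to constants.
  have hmain := h.regret_le_of_pos hγ (η := Real.log T * Q / T) (by positivity) T
  have e1 : Real.log T * Q / T * (1 + regretFactor γ ^ 2) * T =
      (1 + regretFactor γ ^ 2) * (Real.log T * Q) := by field_simp
  have e2 : I.maxCard * (γ * Real.log T) * (N * (1 + Real.log T)) / (2 * (Real.log T * Q / T)) =
      γ * (1 + Real.log T) * Q / 2 := by
    rw [div_eq_iff (by positivity)]
    field_simp
    nlinarith
  have e3 : γ * (1 + Real.log T) * Q / 2 ≤ 3 / 2 * γ * (Real.log T * Q) := by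
    have : 0 ≤ γ * Q := by positivity
    nlinarith
  have e4 : 8 * (N : ℝ) ≤ 16 * (Real.log T * Q) := by nlinarith
  rw [e1, e2] at hmain
  linarith

end IsCLSGRun

/-! ### Lower bound -/

theorem empMean_of_const {N : ℕ} {A : ℕ → Finset (Fin N)} {X : ℕ → Fin N → ℝ} {a : Fin N} {r : ℝ}
    (hX : ∀ t, X (t + 1) a = r) (t : ℕ) :
    empMean A X a t = if pulls A a t = 0 then 0 else r := by
  have h : ∀ τ ∈ (Finset.Ico 1 t).filter (fun τ => a ∈ A τ), X τ a = r := by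
    intro τ hτ
    obtain ⟨k, rfl⟩ : ∃ k, τ = k + 1 :=
      ⟨τ - 1, by have := (Finset.mem_Ico.1 (Finset.mem_filter.1 hτ).1).1; omega⟩
    exact hX k
  rw [empMean, Finset.sum_congr rfl h, Finset.sum_const, nsmul_eq_mul, ← pulls]
  split_ifs with h0
  · simp [h0]
  · field_simp

theorem sum_pulls_eq {N : ℕ} (A : ℕ → Finset (Fin N)) (S : Finset (Fin N)) (t : ℕ) :
    ∑ a ∈ S, pulls A a (t + 1) = ∑ s ∈ Finset.range t, (A (s + 1) ∩ S).card := by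
  induction t with
  | zero => simp [pulls_of_le_one]
  | succ t ih =>
    rw [Finset.sum_range_succ, ← ih]
    simp only [pulls_add_two, Finset.sum_add_distrib]
    rw [← Finset.card_filter, Finset.inter_comm, Finset.filter_mem_eq_inter]

/-- In a maximizer of a sum over the `m`-element sets no exchange of two elements pays. -/
theorem le_of_maximal_sum {α : Type*} [Fintype α] [DecidableEq α] {f : α → ℝ} {m : ℕ}
    {A : Finset α} (hA : A ∈ Finset.univ.powersetCard m)
    (hmax : ∀ B ∈ Finset.univ.powersetCard m, ∑ a ∈ B, f a ≤ ∑ a ∈ A, f a)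
    {g b : α} (hg : g ∈ A) (hb : b ∉ A) : f b ≤ f g := by
  have hcard := (Finset.mem_powersetCard.1 hA).2
  have hb' : b ∉ A.erase g := fun h => hb (Finset.mem_of_mem_erase h)
  have h1 := hmax (insert b (A.erase g)) (Finset.mem_powersetCard.2 ⟨Finset.subset_univ _, by
    rw [Finset.card_insert_of_notMem hb', Finset.card_erase_add_one hg, hcard]⟩)
  rw [Finset.sum_insert hb', ← Finset.add_sum_erase A f hg] at h1
  linarith

/-- If the complement of `G` has been played rarely, a maximizer that prefers rarely played
elements outside `G` to often played elements of `G` contains many elements outside `G`. -/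
theorem half_le_card_sdiff {α : Type*} [Fintype α] [DecidableEq α] {f : α → ℝ} {m u : ℕ}
    {n : α → ℕ} {A G : Finset α} (hu : 0 < u) (hA : A ∈ Finset.univ.powersetCard m)
    (hmax : ∀ B ∈ Finset.univ.powersetCard m, ∑ a ∈ B, f a ≤ ∑ a ∈ A, f a)
    (hG : G.card = m) (hGc : Gᶜ.card = m) (hn : ∀ a, n a ≤ u) (hsum : ∑ a, n a = m * u)
    (hbad : (∑ a ∈ Gᶜ, n a : ℕ) ≤ (m * u / 8 : ℝ))
    (hf : ∀ g ∈ G, ∀ b ∉ G, (u : ℝ) / 2 ≤ n g → (n b : ℝ) ≤ u / 4 → f g < f b) :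
    (m : ℝ) / 2 ≤ (A \ G).card := by
  have hu' : (0 : ℝ) < u := by exact_mod_cast hu
  have hcard := (Finset.mem_powersetCard.1 hA).2
  set Lo := Gᶜ.filter (fun b => (n b : ℝ) ≤ u / 4) with hLo
  set Hi := G.filter (fun g => (u : ℝ) / 2 ≤ n g) with hHi
  have hLo_card : (m : ℝ) / 2 ≤ Lo.card := by
    -- Markov's inequality for counts: at most half of the `m` arms outside `G` can exceed `u/4`
    -- when the total is at most `mu/8`.
    have h1 : ((Gᶜ.filter (fun b => ¬ (n b : ℝ) ≤ u / 4)).card : ℝ) * (u / 4) ≤ m * u / 8 := by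
      refine le_trans ?_ hbad
      rw [← nsmul_eq_mul]
      push_cast
      refine (Finset.card_nsmul_le_sum _ (fun b => (n b : ℝ)) _ fun b hb =>
        (not_le.1 (Finset.mem_filter.1 hb).2).le).trans ?_
      exact Finset.sum_le_sum_of_subset_of_nonneg (Finset.filter_subset _ _)
        fun _ _ _ => Nat.cast_nonneg _
    have h2 : (Lo.card : ℝ) + (Gᶜ.filter (fun b => ¬ (n b : ℝ) ≤ u / 4)).card = m := by
      rw [← hGc]; exact_mod_cast Finset.card_filter_add_card_filter_not _
    have h3 : ((Gᶜ.filter (fun b => ¬ (n b : ℝ) ≤ u / 4)).card : ℝ) ≤ m / 2 := by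
      refine le_of_mul_le_mul_right (h1.trans (le_of_eq ?_)) (by positivity : (0 : ℝ) < u / 4)
      ring
    linarith
  have hHi_card : ((G \ Hi).card : ℝ) ≤ m / 2 := by
    have h1 : ((G \ Hi).card : ℝ) * (u / 2) ≤ m * u / 8 := by
      -- Because all counts are at most `u` and sum to `mu`, the total shortfall `u - n g` over `G`
      -- equals the number of plays outside `G`.
      have h2 : ((G \ Hi).card : ℝ) * (u / 2) ≤ ∑ g ∈ G, ((u : ℝ) - n g) := by
        rw [← nsmul_eq_mul]
        refine (Finset.card_nsmul_le_sum _ (fun g => (u : ℝ) - n g) _ fun g hg => ?_).trans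
          (Finset.sum_le_sum_of_subset_of_nonneg Finset.sdiff_subset fun g _ _ =>
            sub_nonneg.2 (by exact_mod_cast hn g))
        obtain ⟨hgG, hgH⟩ := Finset.mem_sdiff.1 hg
        have : ¬ (u : ℝ) / 2 ≤ n g := fun h => hgH (Finset.mem_filter.2 ⟨hgG, h⟩)
        linarith
      have h3 : (∑ g ∈ G, (n g : ℝ)) + ∑ b ∈ Gᶜ, (n b : ℝ) = m * u := by
        rw [Finset.sum_add_sum_compl]; exact_mod_cast hsum
      rw [Finset.sum_sub_distrib, Finset.sum_const, hG, nsmul_eq_mul] at h2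
      push_cast at hbad
      linarith
    by_contra! h4
    have hm0 : (0 : ℝ) ≤ m := Nat.cast_nonneg m
    nlinarith
  -- A single arm of `Hi` in `A` forces all of `Lo` into `A` by exchange; without one, `A` meets `G`
  -- only in the few arms outside `Hi`.
  by_cases hAH : (A ∩ Hi).Nonempty
  · obtain ⟨g, hg⟩ := hAH
    obtain ⟨hgA, hgH⟩ := Finset.mem_inter.1 hg
    obtain ⟨hgG, hgn⟩ := Finset.mem_filter.1 hgH
    have hsub : Lo ⊆ A \ G := by
      intro b hb
      obtain ⟨hbG, hbn⟩ := Finset.mem_filter.1 hb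
      have hbG' := Finset.mem_compl.1 hbG
      refine Finset.mem_sdiff.2 ⟨?_, hbG'⟩
      by_contra hbA
      exact absurd (le_of_maximal_sum hA hmax hgA hbA) (not_le.2 (hf g hgG b hbG' hgn hbn))
    exact hLo_card.trans (by exact_mod_cast Finset.card_le_card hsub)
  · have hsub : A ∩ G ⊆ G \ Hi := by
      intro g hg
      obtain ⟨hgA, hgG⟩ := Finset.mem_inter.1 hg
      exact Finset.mem_sdiff.2 ⟨hgG, fun h => hAH ⟨g, Finset.mem_inter.2 ⟨hgA, h⟩⟩⟩
    have h1 : ((A ∩ G).card : ℝ) ≤ (G \ Hi).card := by exact_mod_cast Finset.card_le_card hsub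
    have h2 : ((A ∩ G).card : ℝ) + (A \ G).card = m := by
      rw [← hcard]; exact_mod_cast Finset.card_inter_add_card_sdiff A G
    linarith

/-- The arms with positive mean in `twoLevelInstance`. -/
def goodArms (m : ℕ) : Finset (Fin (2 * m)) := Finset.univ.filter (fun a => a.val < m)

theorem card_goodArms (m : ℕ) : (goodArms m).card = m := by
  rw [goodArms, Fin.card_filter_val_lt]
  omega

theorem card_compl_goodArms (m : ℕ) : (goodArms m)ᶜ.card = m := by
  rw [Finset.card_compl, card_goodArms, Fintype.card_fin]
  omega

theorem sum_pulls_compl_goodArms {m : ℕ} {Ω : Type*} (A : ℕ → Ω → Finset (Fin (2 * m)))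
    (t : ℕ) (ω : Ω) :
    ((∑ a ∈ (goodArms m)ᶜ, pulls (fun τ => A τ ω) a (t + 1) : ℕ) : ℝ) =
      ∑ s ∈ Finset.range t, ((A (s + 1) ω \ goodArms m).card : ℝ) := by
  rw [sum_pulls_eq]
  push_cast
  refine Finset.sum_congr rfl fun s _ => ?_
  rw [Finset.sdiff_eq_inter_compl]

/-- The top-`m` instance on `2 * m` arms with deterministic rewards, `Δ` for the first `m` arms and
`0` for the others. -/
noncomputable def twoLevelInstance (m : ℕ) (Δ : ℝ) (hΔ : Δ ∈ Set.Icc (0 : ℝ) 1) :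
    SemiBandit (2 * m) where
  feasible := Finset.univ.powersetCard m
  law a := Measure.dirac (if a ∈ goodArms m then Δ else 0)
  isProb _ := inferInstance
  support a := by
    refine (ae_dirac_iff measurableSet_Icc).2 ?_
    split_ifs
    · exact hΔ
    · simp

section TwoLevel

variable {m : ℕ} {Δ : ℝ} {hΔ : Δ ∈ Set.Icc (0 : ℝ) 1}

theorem mean_twoLevelInstance (a : Fin (2 * m)) :
    (twoLevelInstance m Δ hΔ).mean a = if a ∈ goodArms m then Δ else 0 := by
  simp [SemiBandit.mean, twoLevelInstance]

theorem value_twoLevelInstance (B : Finset (Fin (2 * m))) :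
    (twoLevelInstance m Δ hΔ).value B = Δ * (B ∩ goodArms m).card := by
  simp only [SemiBandit.value, mean_twoLevelInstance]
  rw [← Finset.sum_filter, Finset.filter_mem_eq_inter, Finset.sum_const, nsmul_eq_mul, mul_comm]

theorem le_optValue_twoLevelInstance :
    Δ * m ≤ (twoLevelInstance m Δ hΔ).optValue (twoLevelInstance m Δ hΔ).feasible := by
  have h1 : goodArms m ∈ (twoLevelInstance m Δ hΔ).feasible :=
    Finset.mem_powersetCard.2 ⟨Finset.subset_univ _, card_goodArms m⟩
  refine le_trans (le_of_eq ?_) ((twoLevelInstance m Δ hΔ).value_le_optValue h1)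
  rw [value_twoLevelInstance, Finset.inter_self, card_goodArms]

end TwoLevel

/-- A seed above `1` makes rarely played arms without reward look better than often played arms
with a small reward. -/
theorem index_lt_index {γ Δ w eg eb : ℝ} (hγ : 0 < γ) {T t ng nb : ℕ} (hT : 28 ≤ T)
    (htT : t < T) (hTt : T ≤ 2 * t) (hΔ : Δ = Real.sqrt (γ * Real.log T / T) / 8) (hw : 1 < w)
    (hg : (t : ℝ) / 2 ≤ ng) (hb : (nb : ℝ) ≤ t / 4) (heg : eg ≤ Δ) (heb : 0 ≤ eb) :
    eg + w * Real.sqrt (γ * Real.log ((t + 1 : ℕ) : ℝ) / (ng + 1)) <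
      eb + w * Real.sqrt (γ * Real.log ((t + 1 : ℕ) : ℝ) / (nb + 1)) := by
  have hT' : (28 : ℝ) ≤ T := by exact_mod_cast hT
  have htT' : (t : ℝ) < T := by exact_mod_cast htT
  have hTt' : (T : ℝ) ≤ 2 * t := by exact_mod_cast hTt
  have hlogT : 0 < Real.log T := Real.log_pos (by linarith)
  -- `T ≤ 2t ≤ (t + 1)²`.
  have hlog : Real.log T / 2 ≤ Real.log ((t + 1 : ℕ) : ℝ) := by
    have h1 : Real.log T ≤ Real.log (((t + 1 : ℕ) : ℝ) ^ 2) := by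
      refine Real.log_le_log (by linarith) ?_
      push_cast
      nlinarith
    rw [Real.log_pow] at h1
    push_cast at h1 ⊢
    linarith
  set l := Real.log ((t + 1 : ℕ) : ℝ) with hl
  have hl0 : 0 < l := by linarith
  set sb := Real.sqrt (γ * l / (nb + 1)) with hsb
  set sg := Real.sqrt (γ * l / (ng + 1)) with hsg
  have hsb0 : 0 < sb := Real.sqrt_pos.2 (by positivity)
  have h1 : sg ≤ 3 / 4 * sb := by
    rw [hsg, hsb]
    refine Real.sqrt_le_iff.2 ⟨by positivity, ?_⟩
    rw [mul_pow, Real.sq_sqrt (by positivity), div_le_iff₀ (by positivity), ← mul_div_assoc,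
      div_mul_eq_mul_div, le_div_iff₀ (by positivity)]
    -- This needs `t/4 + 1 ≤ (9/16)(t/2 + 1)`, that is `t ≥ 14`; hence the threshold 28 for `T`.
    have h2 : (nb : ℝ) + 1 ≤ (3 / 4) ^ 2 * (ng + 1) := by linarith
    have h3 : 0 < γ * l := by positivity
    nlinarith
  -- With `sg ≤ 3/4 · sb` and `w > 1`, the bonus advantage exceeds `sb/4 ≥ Δ`.
  have h4 : 4 * Δ ≤ sb := by
    rw [hsb, hΔ]
    refine Real.le_sqrt_of_sq_le ?_
    have h5 : (4 * (Real.sqrt (γ * Real.log T / T) / 8)) ^ 2 = γ * Real.log T / T / 4 := by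
      rw [mul_pow, div_pow, Real.sq_sqrt (by positivity)]
      ring
    rw [h5, div_div, div_le_div_iff₀ (by positivity) (by positivity)]
    have h6 : γ * Real.log T ≤ 2 * (γ * l) := by nlinarith
    have h7 : (nb : ℝ) + 1 ≤ T := by linarith
    have h8 : 0 ≤ γ * l := by positivity
    calc γ * Real.log T * (nb + 1) ≤ 2 * (γ * l) * T :=
          mul_le_mul h6 h7 (by positivity) (by positivity)
      _ ≤ γ * l * (T * 4) := by nlinarith
  nlinarith

/-- Guarantees that the gap `Δ` is a legitimate reward, through `ln T ≤ 2√T` and `γ ≤ √T`. -/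
theorem exists_le_sqrt_log_div (γ : ℝ) (hγ : 0 < γ) :
    ∃ T₀ : ℕ, ∀ T : ℕ, T₀ ≤ T → Real.sqrt (γ * Real.log T / T) / 8 ∈ Set.Icc (0 : ℝ) 1 := by
  refine ⟨⌈γ ^ 2⌉₊ + 1, fun T hT => ⟨by positivity, ?_⟩⟩
  have h1 : γ ^ 2 ≤ T := (Nat.le_ceil _).trans (by exact_mod_cast (by omega : ⌈γ ^ 2⌉₊ ≤ T))
  have hT0 : (0 : ℝ) < T := by exact_mod_cast (by omega : 0 < T)
  have h2 : γ ≤ Real.sqrt T := Real.le_sqrt_of_sq_le h1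
  have h3 : Real.log T ≤ 2 * Real.sqrt T := by
    have h4 := Real.log_le_sub_one_of_pos (Real.sqrt_pos.2 hT0)
    rw [Real.log_sqrt hT0.le] at h4
    linarith
  have h5 : γ * Real.log T / T ≤ 8 ^ 2 := by
    rw [div_le_iff₀ hT0]
    have h6 := Real.mul_self_sqrt hT0.le
    have h7 : γ * Real.log T ≤ γ * (2 * Real.sqrt T) := mul_le_mul_of_nonneg_left h3 hγ.le
    have h8 : γ * Real.sqrt T ≤ Real.sqrt T * Real.sqrt T :=
      mul_le_mul_of_nonneg_right h2 (Real.sqrt_nonneg _)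
    linarith
  rw [div_le_one (by norm_num)]
  exact Real.sqrt_le_iff.2 ⟨by norm_num, h5⟩

theorem card_filter_two_mul_ge {T : ℕ} (hT : 2 ≤ T) :
    (T : ℝ) / 4 ≤ ((Finset.range T).filter (fun t => T ≤ 2 * t)).card := by
  have h : (Finset.range T).filter (fun t => T ≤ 2 * t) = Finset.Ico ((T + 1) / 2) T := by
    ext t; simp only [Finset.mem_filter, Finset.mem_range, Finset.mem_Ico]; omega
  rw [h, Nat.card_Ico]
  have : T ≤ 4 * (T - (T + 1) / 2) := by omega
  have h' : (T : ℝ) ≤ 4 * ((T - (T + 1) / 2 : ℕ) : ℝ) := by exact_mod_cast this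
  linarith

/-! ### Plays of worthless arms in the two-level instance -/

namespace IsCLSGRun

variable {m : ℕ} {Δ : ℝ} {hΔ : Δ ∈ Set.Icc (0 : ℝ) 1} {γ : ℝ} {Ω : Type*} [mΩ : MeasurableSpace Ω]
  {μ : Measure Ω} {𝓕 : Filtration ℕ mΩ} {Θ : ℕ → Ω → Finset (Finset (Fin (2 * m)))}
  {w : ℕ → Ω → ℝ} {A : ℕ → Ω → Finset (Fin (2 * m))} {X : ℕ → Fin (2 * m) → Ω → ℝ}

theorem ae_reward_eq (h : IsCLSGRun (twoLevelInstance m Δ hΔ) γ μ 𝓕 Θ w A X) :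
    ∀ᵐ ω ∂μ, ∀ a t, X (t + 1) a ω = if a ∈ goodArms m then Δ else 0 := by
  refine ae_all_iff.2 fun a => ae_all_iff.2 fun t => ?_
  refine ae_of_ae_map (p := fun x => x = if a ∈ goodArms m then Δ else 0)
    (h.measurable_reward a t).aemeasurable ?_
  rw [h.reward_law]
  simp [twoLevelInstance]

theorem integrable_card_sdiff [IsProbabilityMeasure μ]
    (h : IsCLSGRun (twoLevelInstance m Δ hΔ) γ μ 𝓕 Θ w A X) (t : ℕ) :
    Integrable (fun ω => ((A (t + 1) ω \ goodArms m).card : ℝ)) μ := by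
  have hm : Measurable (fun ω => ((A (t + 1) ω \ goodArms m).card : ℝ)) :=
    measurable_of_finite_index (g := fun B _ => ((B \ goodArms m).card : ℝ))
      (fun B => 𝓕.le _ _ (h.play_meas t B)) fun _ => measurable_const
  refine Integrable.of_bound hm.aestronglyMeasurable ((2 * m : ℕ) : ℝ)
    (Filter.Eventually.of_forall fun ω => ?_)
  rw [Real.norm_of_nonneg (Nat.cast_nonneg _)]
  exact_mod_cast (Finset.card_le_univ _).trans (by simp)

theorem half_le_card_sdiff_goodArms (hγ : 0 < γ) {T t : ℕ}
    (h : IsCLSGRun (twoLevelInstance m Δ hΔ) γ μ 𝓕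
      (fun _ _ => (twoLevelInstance m Δ hΔ).feasible) w A X)
    (hT : 28 ≤ T) (htT : t < T) (hTt : T ≤ 2 * t)
    (hΔT : Δ = Real.sqrt (γ * Real.log T / T) / 8) :
    ∀ᵐ ω ∂μ, 1 < w (t + 1) ω →
      ((∑ a ∈ (goodArms m)ᶜ, pulls (fun τ => A τ ω) a (t + 1) : ℕ) : ℝ) ≤ m * t / 8 →
      (m : ℝ) / 2 ≤ (A (t + 1) ω \ goodArms m).card := by
  filter_upwards [h.ae_reward_eq] with ω hω hw hbad
  refine half_le_card_sdiff (n := fun a => pulls (fun τ => A τ ω) a (t + 1)) (by omega)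
    (h.play_mem t ω) (h.play_max t ω) (card_goodArms m) (card_compl_goodArms m)
    (fun a => pulls_succ_le _ a t) ?_ hbad ?_
  · rw [sum_pulls_eq]
    have : ∀ s ∈ Finset.range t, (A (s + 1) ω ∩ Finset.univ).card = m := fun s _ => by
      rw [Finset.inter_univ]
      exact (Finset.mem_powersetCard.1 (h.play_mem s ω)).2
    rw [Finset.sum_congr rfl this]
    simp [mul_comm]
  · intro g hg b hb hgn hbn
    refine index_lt_index hγ hT htT hTt hΔT hw hgn hbn ?_ ?_
    · rw [empMean_of_const (hω g), if_pos hg]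
      split_ifs
      exacts [hΔ.1, le_rfl]
    · rw [empMean_of_const (hω b), if_neg hb]
      simp

variable [IsProbabilityMeasure μ]

/-- Rarity of the worthless arms is a past event, so it is independent of the seed exceeding 1. -/
theorem integral_card_sdiff_ge (hγ : 0 < γ) {T t : ℕ}
    (h : IsCLSGRun (twoLevelInstance m Δ hΔ) γ μ 𝓕
      (fun _ _ => (twoLevelInstance m Δ hΔ).feasible) w A X)
    (hT : 28 ≤ T) (htT : t < T) (hTt : T ≤ 2 * t)
    (hΔT : Δ = Real.sqrt (γ * Real.log T / T) / 8) :
    m / 2 * ((gaussianReal 0 1).real (Set.Ioi 1) * μ.real {ω |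
      ((∑ a ∈ (goodArms m)ᶜ, pulls (fun τ => A τ ω) a (t + 1) : ℕ) : ℝ) ≤ m * t / 8}) ≤
    ∫ ω, ((A (t + 1) ω \ goodArms m).card : ℝ) ∂μ := by
  set E : Set Ω := {ω |
      ((∑ a ∈ (goodArms m)ᶜ, pulls (fun τ => A τ ω) a (t + 1) : ℕ) : ℝ) ≤ m * t / 8} with hE
  have hEm : MeasurableSet[𝓕 t] E := by
    rw [hE]
    push_cast
    exact measurableSet_le (Finset.measurable_fun_sum _ fun a _ => h.measurable_pulls a t)
      measurable_const
  set f : Ω → ℝ := fun ω => (Set.Ioi (1 : ℝ)).indicator 1 (w (t + 1) ω) with hf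
  have hfm : Measurable[MeasurableSpace.comap (w (t + 1)) inferInstance] f :=
    (measurable_one.indicator measurableSet_Ioi).comp (comap_measurable (w (t + 1)))
  have hgm : Measurable[𝓕 t] (E.indicator (1 : Ω → ℝ)) :=
    (@measurable_const ℝ Ω _ (𝓕 t) 1).indicator hEm
  have hfm' : Measurable f := hfm.mono (h.measurable_seed t).comap_le le_rfl
  have hfi : ∫ ω, f ω ∂μ = (gaussianReal 0 1).real (Set.Ioi 1) := by
    rw [← h.seed_law t, ← integral_indicator_one measurableSet_Ioi,
      integral_map (h.measurable_seed t).aemeasurable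
        (measurable_one.indicator measurableSet_Ioi).aestronglyMeasurable]
  rw [← hfi, ← integral_indicator_one (𝓕.le t _ hEm),
    ← (h.indepFun_seed t hfm hgm).integral_fun_mul_eq_mul_integral hfm'.aestronglyMeasurable
      (hgm.mono (𝓕.le t) le_rfl).aestronglyMeasurable, ← integral_const_mul]
  refine integral_mono_of_nonneg (Filter.Eventually.of_forall fun ω => ?_)
    (h.integrable_card_sdiff t) ?_
  · exact mul_nonneg (by positivity) (mul_nonneg
      (Set.indicator_nonneg (fun _ _ => zero_le_one) _)
      (Set.indicator_nonneg (fun _ _ => zero_le_one) _))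
  · filter_upwards [h.half_le_card_sdiff_goodArms hγ hT htT hTt hΔT] with ω hω
    by_cases h1 : 1 < w (t + 1) ω
    · by_cases h2 : ω ∈ E
      · simp only [hf, Set.indicator_of_mem (Set.mem_Ioi.2 h1), Set.indicator_of_mem h2,
          Pi.one_apply, mul_one]
        exact hω h1 h2
      · simp [Set.indicator_of_notMem h2]
    · simp [hf, Set.indicator_of_notMem (fun hlt => h1 (Set.mem_Ioi.1 hlt))]

/-- CL-SG plays arms without reward a constant fraction of the time. -/
theorem sum_integral_card_sdiff_ge (hγ : 0 < γ) {T : ℕ}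
    (h : IsCLSGRun (twoLevelInstance m Δ hΔ) γ μ 𝓕
      (fun _ _ => (twoLevelInstance m Δ hΔ).feasible) w A X)
    (hT : 28 ≤ T) (hΔT : Δ = Real.sqrt (γ * Real.log T / T) / 8) :
    (gaussianReal 0 1).real (Set.Ioi 1) / 32 * (m * T) ≤
      ∑ t ∈ Finset.range T, ∫ ω, ((A (t + 1) ω \ goodArms m).card : ℝ) ∂μ := by
  set p := (gaussianReal 0 1).real (Set.Ioi (1 : ℝ)) with hp
  have hp0 : 0 ≤ p := measureReal_nonneg
  have hp1 : p ≤ 1 := measureReal_le_one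
  set Z : ℕ → Ω → ℝ := fun t ω => ∑ s ∈ Finset.range t, ((A (s + 1) ω \ goodArms m).card : ℝ)
    with hZ
  have hmono : ∀ {s t : ℕ} (ω : Ω), s ≤ t → Z s ω ≤ Z t ω := fun ω hst =>
    Finset.sum_le_sum_of_subset_of_nonneg (Finset.range_mono hst) fun _ _ _ => Nat.cast_nonneg _
  -- The level makes `E` imply rarity in every round with `2t ≥ T`, as `mT/16 ≤ mt/8`. On `E` these
  -- at least `T/4` rounds produce many worthless plays; off `E` the total is large by definition.
  -- Adding both bounds gives `2 E[Z T] ≥ p m T / 16`.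
  set E : Set Ω := {ω | Z T ω ≤ m * T / 16} with hE
  have iZ : Integrable (Z T) μ := integrable_finsetSum _ fun t _ => h.integrable_card_sdiff t
  have hsumZ : ∑ t ∈ Finset.range T, ∫ ω, ((A (t + 1) ω \ goodArms m).card : ℝ) ∂μ =
      ∫ ω, Z T ω ∂μ := (integral_finsetSum _ fun t _ => h.integrable_card_sdiff t).symm
  have hEm : MeasurableSet E := by
    have : Measurable (Z T) := Finset.measurable_fun_sum _ fun t _ =>
      measurable_of_finite_index (g := fun B _ => ((B \ goodArms m).card : ℝ))
        (fun B => 𝓕.le _ _ (h.play_meas t B)) fun _ => measurable_const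
    exact measurableSet_le this measurable_const
  have hmT : (0 : ℝ) ≤ m * T := by positivity
  have hfirst : m * T * p / 16 * μ.real E ≤ ∫ ω, Z T ω ∂μ := by
    have hround : ∀ t ∈ (Finset.range T).filter (fun t => T ≤ 2 * t),
        m / 2 * (p * μ.real E) ≤ ∫ ω, ((A (t + 1) ω \ goodArms m).card : ℝ) ∂μ := by
      intro t ht
      obtain ⟨htT, hTt⟩ := Finset.mem_filter.1 ht
      have htT' := Finset.mem_range.1 htT
      refine le_trans ?_ (h.integral_card_sdiff_ge hγ hT htT' hTt hΔT)
      have hsub : E ⊆ {ω | ((∑ a ∈ (goodArms m)ᶜ,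
          pulls (fun τ => A τ ω) a (t + 1) : ℕ) : ℝ) ≤ m * t / 8} := by
        intro ω hω
        rw [Set.mem_ofPred_eq, sum_pulls_compl_goodArms]
        refine (hmono ω htT'.le).trans (le_trans hω ?_)
        have : (T : ℝ) ≤ 2 * t := by exact_mod_cast hTt
        have hm0 : (0 : ℝ) ≤ m := Nat.cast_nonneg m
        nlinarith
      exact mul_le_mul_of_nonneg_left
        (mul_le_mul_of_nonneg_left (measureReal_mono hsub) hp0) (by positivity)
    have h1 := Finset.card_nsmul_le_sum _ _ _ hround
    rw [nsmul_eq_mul] at h1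
    rw [← hsumZ]
    refine le_trans ?_ (h1.trans (Finset.sum_le_sum_of_subset_of_nonneg (Finset.filter_subset _ _)
      fun t _ _ => integral_nonneg fun ω => Nat.cast_nonneg _))
    have h2 := card_filter_two_mul_ge (T := T) (by omega)
    have h3 : 0 ≤ m / 2 * (p * μ.real E) := by positivity
    have h4 := mul_le_mul_of_nonneg_right h2 h3
    have h5 : 0 ≤ m * T * p * μ.real E := by positivity
    linarith
  have hsecond : m * T * p / 16 * (1 - μ.real E) ≤ ∫ ω, Z T ω ∂μ := by
    rw [← probReal_compl_eq_one_sub hEm, ← integral_indicator_one hEm.compl,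
      ← integral_const_mul]
    refine integral_mono_of_nonneg (Filter.Eventually.of_forall fun ω =>
      mul_nonneg (by positivity) (Set.indicator_nonneg (fun _ _ => zero_le_one) _)) iZ
      (Filter.Eventually.of_forall fun ω => ?_)
    by_cases hω : ω ∈ E
    · simp only [Set.indicator_of_notMem (Set.notMem_compl_iff.2 hω), mul_zero]
      exact Finset.sum_nonneg fun _ _ => Nat.cast_nonneg _
    · simp only [Set.indicator_of_mem (Set.mem_compl hω), Pi.one_apply, mul_one]
      have h1 : m * T / 16 ≤ Z T ω := (not_le.1 hω).le
      nlinarith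
  rw [hsumZ]
  linarith

/-- Each worthless play costs `Δ`, and `Δ T = √(γ T ln T) / 8`. The constant is `1/512 = 1/32 · 1/8
· 1/2`, the last factor from the crude `√2 ≤ 2`. -/
theorem regret_ge (hγ : 0 < γ) {T : ℕ}
    (h : IsCLSGRun (twoLevelInstance m Δ hΔ) γ μ 𝓕
      (fun _ _ => (twoLevelInstance m Δ hΔ).feasible) w A X)
    (hT : 28 ≤ T) (hΔT : Δ = Real.sqrt (γ * Real.log T / T) / 8) :
    (gaussianReal 0 1).real (Set.Ioi 1) * Real.sqrt γ / 512 *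
        Real.sqrt (m * (2 * m : ℕ) * T * Real.log T) ≤
      regret (twoLevelInstance m Δ hΔ) μ (fun _ _ => (twoLevelInstance m Δ hΔ).feasible) A T := by
  set J := twoLevelInstance m Δ hΔ with hJ
  have hround : ∀ t, Δ * ∫ ω, ((A (t + 1) ω \ goodArms m).card : ℝ) ∂μ ≤
      ∫ ω, (J.optValue J.feasible - J.value (A (t + 1) ω)) ∂μ := by
    intro t
    have h1 : ∀ ω, J.optValue J.feasible - J.value (A (t + 1) ω) =
        (J.optValue J.feasible - Δ * m) + Δ * ((A (t + 1) ω \ goodArms m).card : ℝ) := by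
      intro ω
      have h2 : ((A (t + 1) ω ∩ goodArms m).card : ℝ) + (A (t + 1) ω \ goodArms m).card = m := by
        exact_mod_cast (Finset.card_inter_add_card_sdiff (A (t + 1) ω) (goodArms m)).trans
          (Finset.mem_powersetCard.1 (h.play_mem t ω)).2
      rw [hJ, value_twoLevelInstance, ← h2]
      ring
    simp only [h1]
    rw [integral_add (integrable_const _) ((h.integrable_card_sdiff t).const_mul Δ),
      integral_const_mul, integral_const, probReal_univ, one_smul]
    have := le_optValue_twoLevelInstance (m := m) (hΔ := hΔ)
    linarith
  have hsum := h.sum_integral_card_sdiff_ge hγ hT hΔT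
  rw [regret_eq_sum_range]
  refine le_trans ?_ (Finset.sum_le_sum fun t _ => hround t)
  rw [← Finset.mul_sum]
  refine le_trans ?_ (mul_le_mul_of_nonneg_left hsum hΔ.1)
  have hT0 : (0 : ℝ) < T := by exact_mod_cast (by omega : 0 < T)
  have hlog : 0 ≤ Real.log T := Real.log_natCast_nonneg T
  have hp0 : 0 ≤ (gaussianReal 0 1).real (Set.Ioi (1 : ℝ)) := measureReal_nonneg
  have e1 : Real.sqrt (m * (2 * m : ℕ) * T * Real.log T) ≤ 2 * m * Real.sqrt (T * Real.log T) := by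
    refine Real.sqrt_le_iff.2 ⟨by positivity, ?_⟩
    rw [mul_pow, Real.sq_sqrt (by positivity)]
    push_cast
    have : (0 : ℝ) ≤ m * m * T * Real.log T := by positivity
    nlinarith
  have e2 : Δ * T = Real.sqrt γ * Real.sqrt (T * Real.log T) / 8 := by
    rw [hΔT, ← Real.sqrt_mul hγ.le, div_mul_eq_mul_div]
    congr 1
    have : γ * (T * Real.log T) = γ * Real.log T / T * (T * T) := by field_simp
    rw [this, Real.sqrt_mul (by positivity), Real.sqrt_mul_self hT0.le]
  calc _ ≤ (gaussianReal 0 1).real (Set.Ioi (1 : ℝ)) * Real.sqrt γ / 512 *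
        (2 * m * Real.sqrt (T * Real.log T)) := mul_le_mul_of_nonneg_left e1 (by positivity)
    _ = (gaussianReal 0 1).real (Set.Ioi (1 : ℝ)) / 32 * m *
        (Real.sqrt γ * Real.sqrt (T * Real.log T) / 8) := by ring
    _ = _ := by rw [← e2]; ring

end IsCLSGRun

/-! ### Running CL-SG on an instance with deterministic rewards -/

/-- An element of a nonempty finite family. -/
noncomputable def pick {α : Type*} (M : Finset (Finset α)) : Finset α :=
  if h : M.Nonempty then h.choose else ∅

theorem pick_mem {α : Type*} {M : Finset (Finset α)} (h : M.Nonempty) : pick M ∈ M := by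
  rw [pick, dif_pos h]
  exact h.choose_spec

section Choice

variable {N : ℕ} (S : Finset (Finset (Fin N))) (γ : ℝ) (r : Fin N → ℝ)

/-- The perturbed estimate in round `t` for deterministic rewards `r`, counts `n` and seed `x`. -/
noncomputable def countIndex (t : ℕ) (n : Fin N → ℕ) (x : ℝ) (a : Fin N) : ℝ :=
  (if n a = 0 then 0 else r a) + x * Real.sqrt (γ * Real.log t / ((n a : ℝ) + 1))

open Classical in
/-- The super arms in `S` that maximize the sum of the perturbed estimates. -/
noncomputable def maximizers (t : ℕ) (n : Fin N → ℕ) (x : ℝ) : Finset (Finset (Fin N)) :=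
  S.filter fun B => ∀ C ∈ S, ∑ a ∈ C, countIndex γ r t n x a ≤ ∑ a ∈ B, countIndex γ r t n x a

theorem maximizers_nonempty (hS : S.Nonempty) (t : ℕ) (n : Fin N → ℕ) (x : ℝ) :
    (maximizers S γ r t n x).Nonempty := by
  obtain ⟨B, hB, hmax⟩ := S.exists_max_image (fun B => ∑ a ∈ B, countIndex γ r t n x a) hS
  exact ⟨B, Finset.mem_filter.2 ⟨hB, hmax⟩⟩

theorem measurableSet_mem_maximizers (t : ℕ) (n : Fin N → ℕ) (B : Finset (Fin N)) :
    MeasurableSet {x | B ∈ maximizers S γ r t n x} := by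
  have hm : ∀ C : Finset (Fin N), Measurable fun x => ∑ a ∈ C, countIndex γ r t n x a :=
    fun C => Finset.measurable_fun_sum _ fun a _ =>
      measurable_const.add (measurable_id.mul_const _)
  have : {x | B ∈ maximizers S γ r t n x} = {_x | B ∈ S} ∩ ⋂ C ∈ S,
      {x | ∑ a ∈ C, countIndex γ r t n x a ≤ ∑ a ∈ B, countIndex γ r t n x a} := by
    ext x; simp [maximizers]
  rw [this]
  exact (MeasurableSet.const _).inter
    (Finset.measurableSet_biInter _ fun C _ => measurableSet_le (hm C) (hm B))

theorem measurableSet_maximizers_eq (t : ℕ) (n : Fin N → ℕ) (M : Finset (Finset (Fin N))) :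
    MeasurableSet {x | maximizers S γ r t n x = M} := by
  have : {x | maximizers S γ r t n x = M} = ⋂ B, {x | B ∈ maximizers S γ r t n x ↔ B ∈ M} := by
    ext x; simp [Finset.ext_iff]
  rw [this]
  exact MeasurableSet.iInter fun B =>
    (measurableSet_mem_maximizers S γ r t n B).iff (MeasurableSet.const _)

/-- `pick` is an arbitrary choice, but it sees the seed only through the finite family of
maximizers. -/
theorem measurableSet_pick_eq (t : ℕ) (n : Fin N → ℕ) (B : Finset (Fin N)) :
    MeasurableSet {x | pick (maximizers S γ r t n x) = B} := by
  have : {x | pick (maximizers S γ r t n x) = B} =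
      ⋃ M ∈ {M | pick M = B}, {x | maximizers S γ r t n x = M} := by
    ext x; simp
  rw [this]
  exact MeasurableSet.biUnion (Set.to_countable _) fun M _ =>
    measurableSet_maximizers_eq S γ r t n M

/-- The counts after `t` rounds when the seeds are `x 1, x 2, …`. -/
noncomputable def greedyCounts (x : ℕ → ℝ) : ℕ → Fin N → ℕ
  | 0 => 0
  | t + 1 => fun a => greedyCounts x t a +
      if a ∈ pick (maximizers S γ r (t + 1) (greedyCounts x t) (x (t + 1))) then 1 else 0

/-- The super arm that is played in round `t` when the seeds are `x 1, x 2, …`. -/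
noncomputable def greedyPlay (t : ℕ) (x : ℕ → ℝ) : Finset (Fin N) :=
  pick (maximizers S γ r t (greedyCounts S γ r x (t - 1)) (x t))

/-- With deterministic rewards the counts are a complete state, so the recursion needs to carry
nothing else. -/
theorem pulls_greedyPlay (x : ℕ → ℝ) (a : Fin N) (t : ℕ) :
    pulls (fun τ => greedyPlay S γ r τ x) a (t + 1) = greedyCounts S γ r x t a := by
  induction t with
  | zero => simp [pulls_of_le_one, greedyCounts]
  | succ t ih =>
    rw [pulls_add_two, ih, greedyCounts]
    rfl

theorem perturbed_greedyPlay (x : ℕ → ℝ) (y : ℝ) (a : Fin N) (t : ℕ) :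
    perturbed γ (fun τ => greedyPlay S γ r τ x) (fun _ b => r b) y a (t + 1) =
      countIndex γ r (t + 1) (greedyCounts S γ r x t) y a := by
  rw [perturbed, empMean_of_const (r := r a) (fun _ => rfl), pulls_greedyPlay, countIndex]

/-- The filtration generated by the seeds. -/
def seedFiltration : Filtration ℕ (inferInstance : MeasurableSpace (ℕ → ℝ)) :=
  Filtration.natural (fun t x => x t) fun t => (measurable_pi_apply t).stronglyMeasurable

theorem measurable_seedFiltration (t : ℕ) : Measurable[seedFiltration t] (fun x : ℕ → ℝ => x t) :=
  (Filtration.stronglyAdapted_natural (u := fun t (x : ℕ → ℝ) => x t)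
    (fun t => (measurable_pi_apply t).stronglyMeasurable) t).measurable

/-- Splits over the countably many count vectors. Measurability of the counts is a hypothesis
because this serves inside the induction of `measurableSet_greedyCounts`. -/
theorem measurableSet_greedyPlay_of_counts {t : ℕ}
    (hc : ∀ v, MeasurableSet[seedFiltration t] {x | greedyCounts S γ r x t = v})
    (B : Finset (Fin N)) :
    MeasurableSet[seedFiltration (t + 1)] {x | greedyPlay S γ r (t + 1) x = B} := by
  have : {x | greedyPlay S γ r (t + 1) x = B} = ⋃ v : Fin N → ℕ, {x | greedyCounts S γ r x t = v} ∩
      (fun x : ℕ → ℝ => x (t + 1)) ⁻¹' {y | pick (maximizers S γ r (t + 1) v y) = B} := by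
    ext x; simp [greedyPlay]
  rw [this]
  exact MeasurableSet.iUnion fun v => (seedFiltration.mono (Nat.le_succ t) _ (hc v)).inter
    (measurable_seedFiltration (t + 1) (measurableSet_pick_eq S γ r (t + 1) v B))

theorem measurableSet_greedyCounts (t : ℕ) (v : Fin N → ℕ) :
    MeasurableSet[seedFiltration t] {x | greedyCounts S γ r x t = v} := by
  induction t generalizing v with
  | zero => exact MeasurableSet.const (0 = v)
  | succ t ih =>
    have : {x | greedyCounts S γ r x (t + 1) = v} = ⋃ B : Finset (Fin N), ⋃ u ∈
        {u : Fin N → ℕ | (fun a => u a + if a ∈ B then 1 else 0) = v},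
        {x | greedyPlay S γ r (t + 1) x = B} ∩ {x | greedyCounts S γ r x t = u} := by
      ext x; simp [greedyPlay, greedyCounts]
    rw [this]
    exact MeasurableSet.iUnion fun B => MeasurableSet.biUnion (Set.to_countable _) fun u _ =>
      (measurableSet_greedyPlay_of_counts S γ r ih B).inter
        (seedFiltration.mono (Nat.le_succ t) _ (ih u))

end Choice

/-- CL-SG can be run on every instance with deterministic rewards. -/
theorem isCLSGRun_greedyPlay {N : ℕ} (I : SemiBandit N) (hS : I.feasible.Nonempty) (γ : ℝ)
    (r : Fin N → ℝ) (hr : ∀ a, I.law a = Measure.dirac (r a)) :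
    IsCLSGRun I γ (Measure.infinitePi fun _ : ℕ => gaussianReal 0 1) seedFiltration
      (fun _ _ => I.feasible) (fun t x => x t) (greedyPlay I.feasible γ r)
      (fun _ a _ => r a) where
  avail_meas _ _ := MeasurableSet.const _
  avail_subset _ _ := subset_rfl
  avail_nonempty _ _ := hS
  seed_meas t := measurable_seedFiltration (t + 1)
  seed_law t := Measure.infinitePi_map_eval (fun _ : ℕ => gaussianReal 0 1) (t + 1)
  seed_indep t := (iIndepFun_infinitePi (P := fun _ : ℕ => gaussianReal 0 1)
    (X := fun _ x => x) fun _ => measurable_id).indep_comap_natural_of_lt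
      (fun t => (measurable_pi_apply t).stronglyMeasurable) (Nat.lt_succ_self t)
  play_meas t B := measurableSet_greedyPlay_of_counts _ _ _ (measurableSet_greedyCounts _ _ _ t) B
  play_mem _ _ := (Finset.mem_filter.1 (pick_mem (maximizers_nonempty _ γ r hS _ _ _))).1
  play_max t x B hB := by
    simp only [perturbed_greedyPlay]
    exact (Finset.mem_filter.1 (pick_mem (maximizers_nonempty _ γ r hS _ _ _))).2 B hB
  reward_meas _ _ := measurable_const
  reward_law t a := by rw [Measure.map_const, hr]; simp
  -- Constant rewards generate the trivial σ-algebra.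
  reward_indep t := by
    rw [MeasurableSpace.comap_const]
    exact indep_bot_left _

theorem theorem2 (γ : ℝ) (hγ : 0 < γ) :
    (∃ C : ℝ, ∀ (N : ℕ) (I : SemiBandit N) (Ω : Type*) [mΩ : MeasurableSpace Ω]
      (μ : Measure Ω) [IsProbabilityMeasure μ] (𝓕 : Filtration ℕ mΩ)
      (Θ : ℕ → Ω → Finset (Finset (Fin N))) (w : ℕ → Ω → ℝ) (A : ℕ → Ω → Finset (Fin N))
      (X : ℕ → Fin N → Ω → ℝ), IsCLSGRun I γ μ 𝓕 Θ w A X →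
      ∀ T : ℕ, 2 ≤ T →
        regret I μ Θ A T ≤ C * (Real.log T * Real.sqrt (I.maxCard * N * T))) ∧
    (∃ c : ℝ, 0 < c ∧ ∃ T₀ : ℕ, ∀ m : ℕ, 1 ≤ m → ∀ T : ℕ, T₀ ≤ T →
      ∃ I : SemiBandit (2 * m), I.IsTop m ∧
        (∃ (Ω : Type) (mΩ : MeasurableSpace Ω) (μ : Measure Ω) (𝓕 : Filtration ℕ mΩ)
          (w : ℕ → Ω → ℝ) (A : ℕ → Ω → Finset (Fin (2 * m))) (X : ℕ → Fin (2 * m) → Ω → ℝ),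
          IsProbabilityMeasure μ ∧ IsCLSGRun I γ μ 𝓕 (fun _ _ => I.feasible) w A X) ∧
        ∀ (Ω : Type*) [mΩ : MeasurableSpace Ω] (μ : Measure Ω) [IsProbabilityMeasure μ]
          (𝓕 : Filtration ℕ mΩ) (w : ℕ → Ω → ℝ) (A : ℕ → Ω → Finset (Fin (2 * m)))
          (X : ℕ → Fin (2 * m) → Ω → ℝ),
          IsCLSGRun I γ μ 𝓕 (fun _ _ => I.feasible) w A X →
          c * Real.sqrt (m * (2 * m : ℕ) * T * Real.log T) ≤
            regret I μ (fun _ _ => I.feasible) A T) := by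
  refine ⟨⟨1 + regretFactor γ ^ 2 + 3 / 2 * γ + 16, ?_⟩, ?_⟩
  · intro N I Ω mΩ μ _ 𝓕 Θ w A X h T hT
    exact h.regret_le hγ hT
  · obtain ⟨T₁, hT₁⟩ := exists_le_sqrt_log_div γ hγ
    -- `T₁` makes `Δ` a valid reward; 28 is what `index_lt_index` requires.
    refine ⟨(gaussianReal 0 1).real (Set.Ioi 1) * Real.sqrt γ / 512, ?_, max T₁ 28, ?_⟩
    · have := gaussianReal_real_Ioi_pos 1
      have := Real.sqrt_pos.2 hγ
      positivity
    intro m _ T hT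
    refine ⟨twoLevelInstance m _ (hT₁ T (le_of_max_le_left hT)), rfl, ?_, ?_⟩
    · exact ⟨ℕ → ℝ, inferInstance, _, _, _, _, _, inferInstance,
        isCLSGRun_greedyPlay _ ⟨goodArms m, Finset.mem_powersetCard.2
          ⟨Finset.subset_univ _, card_goodArms m⟩⟩ γ _ fun _ => rfl⟩
    · intro Ω mΩ μ _ 𝓕 w A X h
      exact h.regret_ge hγ (le_of_max_le_right hT) rfl
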